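/- Let $N\in\mathbb{N}$, $1<p<N$, $0\le\gamma<\left(\frac{N-p}{p}\right)^p$, and let $\gamma_2$ be the larger of the two nonnegative roots $\mu$ of $$\mu^{p-2}\left[(p-1)\mu^2-(N-p)\mu\right]+\gamma=0 .$$ Let $0<\alpha<1$ and let $v\in C^{1,\alpha}_{loc}(\mathbb{R}^N\setminus\{0\})$ be a positive weak solution of $$-\Delta_p v-\frac{\gamma}{|x|^p}v^{p-1}=0\quad\text{in }\mathbb{R}^N\setminus\{0\},$$ that is, $\int_{\mathbb{R}^N}|\nabla v|^{p-2}\nabla v\cdot\nabla\varphi\,dx=\int_{\mathbb{R}^N}\frac{\gamma}{|x|^p}v^{p-1}\varphi\,dx$ for every $\varphi\in C_c^\infty(\mathbb{R}^N\setminus\{0\})$. Assume that $\lim_{|x|\to0}v(x)=\infty$ and that there are constants $c,C,R>0$ with $$c|x|^{-\gamma_2}\le v(x)\le C|x|^{-\gamma_2}\quad\text{for }|x|>R .$$ Then $v$ is radial about the origin and strictly radially decreasing, with strictly negative radial derivative: there is a strictly decreasing function $f:(0,\infty)\to\mathbb{R}$ with $f'(r)<0$ for every $r>0$ such that $v(x)=f(|x|)$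 for all $x\ne0$. -/

import Mathlib

open Set Filter Topology MeasureTheory
open scoped NNReal ContDiff Gradient

namespace HardyPLaplace

/-- `v` is of class `C^{1,α}_loc` on `U`: it is `C¹` there and its gradient is `α`-Hölder
continuous on every compact subset of `U`. -/
def IsC1HolderLoc {N : ℕ} (α : ℝ≥0) (U : Set (EuclideanSpace ℝ (Fin N)))
    (v : EuclideanSpace ℝ (Fin N) → ℝ) : Prop :=
  ContDiffOn ℝ 1 v U ∧
    ∀ K ⊆ U, IsCompact K → ∃ C : ℝ≥0, HolderOnWith C α (fun x => ∇ v x) K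

/-- `v` satisfies `-Δ_p v - γ |x|^{-p} v^{p-1} = 0` in the weak sense on `ℝ^N ∖ {0}`, tested against
all `φ ∈ C_c^∞(ℝ^N ∖ {0})`. It is used for `v` that are positive and `C¹` on `ℝ^N ∖ {0}` and for
`1 < p`; then both integrands are continuous with compact support in `ℝ^N ∖ {0}`
(at critical points of `v` the left integrand is `0`). -/
def IsWeakSolution {N : ℕ} (p γ : ℝ) (v : EuclideanSpace ℝ (Fin N) → ℝ) : Prop :=
  ∀ φ : EuclideanSpace ℝ (Fin N) → ℝ,
    ContDiff ℝ ∞ φ → HasCompactSupport φ → tsupport φ ⊆ {0}ᶜ →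
      ∫ x, ‖∇ v x‖ ^ (p - 2) * inner ℝ (∇ v x) (∇ φ x) =
        ∫ x, γ / ‖x‖ ^ p * v x ^ (p - 1) * φ x

/-- The nonnegative roots `μ` of `μ^{p-2} ((p-1) μ² - (N-p) μ) + γ = 0`. For `1 < p < N` and
`0 ≤ γ < ((N-p)/p)^p` there are exactly two of them, `γ₁ < γ₂`. -/
def exponentRoots (N : ℕ) (p γ : ℝ) : Set ℝ :=
  {μ : ℝ | 0 ≤ μ ∧ μ ^ (p - 2) * ((p - 1) * μ ^ 2 - (N - p) * μ) + γ = 0}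

/-- Two-sided decay of order `|x|^{-g}` at infinity. -/
def HasTwoSidedDecay {N : ℕ} (g : ℝ) (v : EuclideanSpace ℝ (Fin N) → ℝ) : Prop :=
  ∃ c C R : ℝ, 0 < c ∧ 0 < C ∧ 0 < R ∧ ∀ x : EuclideanSpace ℝ (Fin N), R < ‖x‖ →
    c * ‖x‖ ^ (-g) ≤ v x ∧ v x ≤ C * ‖x‖ ^ (-g)

end HardyPLaplace

/-!
A solution of this equation is compared with its own reflections, and no moving plane is needed.

Let `s` be the reflection in a hyperplane that misses the origin, and let `H` be the open half-space
on the side away from the origin, that is, where `‖s z‖ < ‖z‖`. There `v` and `v ∘ s` solve equations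
`-Δ_p u = V u^{p-1}` in which the reflected solution has the larger potential,
`γ / ‖z‖^p ≤ γ / ‖s z‖^p`. The two functions agree on the mirror, and near the only singular point
`s 0` of `H` the function `v ∘ s` is infinite while `v` is bounded. With `U = log v` and
`W = U ∘ s`, both equations take the Riccati form `-Δ_p U - (p - 1) |∇ U|^p = V`, whose weak
formulation for `U` and `W` is tested with `exp (p U) K ψ`. Here `K = g (U - W)` on `H`, continued
by `0`, for a bounded nondecreasing `g` that vanishes on `(-∞, δ]`, and `ψ` is a cutoff at infinity.
In the difference of the two identities the terms with `K` are nonnegative by Picone's inequality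
(`picone`), those with `∇ K` by the monotonicity of the flux, and the potentials have the good sign.
The terms with `∇ ψ` tend to zero (`exists_cutoff`): Caccioppoli's inequality
(`exists_caccioppoli`) bounds them at scale `r` by `r^{N - p - γ₂ p}`, and the larger root satisfies
`γ₂ > (N - p) / p` (`lt_of_isGreatest_exponentRoots`). So `∇ K = 0`
(`gradient_eq_zero_of_comparison`), hence `K = 0`, and `v ≤ v ∘ s` on `H`
(`le_comp_reflection`).

Any two points of different norm are exchanged by such a reflection, so `v x ≤ v y` whenever
`0 < ‖y‖ < ‖x‖`; by continuity `v` is radial, `v x = f ‖x‖` with `f` nonincreasing. In polar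
coordinates the equation says that `r^{N-1} |f'|^{p-1}` does not decrease
(`flux_monotone_of_radial`). A zero of `f'` would therefore make `f` constant near the origin, where
it is infinite (`exists_radial_profile`).
-/

namespace HardyPLaplace

/-! ### Gradients -/

section Calculus

variable {E : Type*} [NormedAddCommGroup E] [InnerProductSpace ℝ E] [CompleteSpace E]

theorem hasGradientAt_mul {f g : E → ℝ} {f' g' x : E} (hf : HasGradientAt f f' x)
    (hg : HasGradientAt g g' x) :
    HasGradientAt (fun y => f y * g y) (f x • g' + g x • f') x := by
  rw [hasGradientAt_iff_hasFDerivAt] at *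
  refine (hf.mul hg).congr_fderiv ?_
  simp only [map_add, map_smul]

theorem hasGradientAt_comp {f : E → ℝ} {g : ℝ → ℝ} {g' : ℝ} {f' x : E}
    (hg : HasDerivAt g g' (f x)) (hf : HasGradientAt f f' x) :
    HasGradientAt (fun y => g (f y)) (g' • f') x := by
  rw [hasGradientAt_iff_hasFDerivAt] at *
  refine (hg.comp_hasFDerivAt x hf).congr_fderiv ?_
  simp only [map_smul]

theorem hasGradientAt_sub {f g : E → ℝ} {f' g' x : E} (hf : HasGradientAt f f' x)
    (hg : HasGradientAt g g' x) : HasGradientAt (fun y => f y - g y) (f' - g') x := by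
  rw [hasGradientAt_iff_hasFDerivAt] at *
  refine (hf.sub hg).congr_fderiv ?_
  simp only [map_sub]

theorem norm_gradient (f : E → ℝ) (x : E) : ‖∇ f x‖ = ‖fderiv ℝ f x‖ := by
  simp [gradient]

theorem continuousOn_gradient {f : E → ℝ} {Ω : Set E} (hΩ : IsOpen Ω)
    (hf : ContDiffOn ℝ 1 f Ω) : ContinuousOn (∇ f) Ω :=
  (InnerProductSpace.toDual ℝ E).symm.continuous.comp_continuousOn
    (hf.continuousOn_fderiv_of_isOpen hΩ le_rfl)

theorem continuous_gradient {f : E → ℝ} (hf : ContDiff ℝ 1 f) : Continuous (∇ f) :=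
  (InnerProductSpace.toDual ℝ E).symm.continuous.comp (hf.continuous_fderiv one_ne_zero)

theorem hasGradientAt_of_contDiffOn {f : E → ℝ} {Ω : Set E} (hΩ : IsOpen Ω)
    (hf : ContDiffOn ℝ 1 f Ω) {x : E} (hx : x ∈ Ω) : HasGradientAt f (∇ f x) x :=
  ((hf.contDiffAt (hΩ.mem_nhds hx)).differentiableAt one_ne_zero).hasGradientAt

theorem hasGradientAt_of_contDiff {f : E → ℝ} (hf : ContDiff ℝ 1 f) (x : E) :
    HasGradientAt f (∇ f x) x :=
  (hf.differentiable one_ne_zero x).hasGradientAt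

theorem gradient_eq_zero_of_notMem_tsupport {f : E → ℝ} {x : E} (hx : x ∉ tsupport f) :
    ∇ f x = 0 := by
  rw [(notMem_tsupport_iff_eventuallyEq.1 hx).gradient_eq]
  exact gradient_fun_const x 0

theorem tsupport_gradient_subset (f : E → ℝ) : tsupport (∇ f) ⊆ tsupport f := by
  refine closure_minimal (fun x hx => ?_) (isClosed_tsupport f)
  by_contra h
  exact hx (gradient_eq_zero_of_notMem_tsupport h)

/-- A function that is continuous on an open set and supported in it is continuous. -/
theorem continuous_of_continuousOn_of_tsupport_subset {X Y : Type*} [TopologicalSpace X]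
    [TopologicalSpace Y] [Zero Y] {f : X → Y} {Ω : Set X} (hΩ : IsOpen Ω)
    (hf : ContinuousOn f Ω) (hs : tsupport f ⊆ Ω) : Continuous f :=
  continuous_of_tsupport fun _ hx => hf.continuousAt (hΩ.mem_nhds (hs hx))

theorem contDiff_of_contDiffOn_of_tsupport_subset {F : Type*} [NormedAddCommGroup F]
    [NormedSpace ℝ F] {f : F → ℝ} {Ω : Set F} (hΩ : IsOpen Ω)
    (hf : ContDiffOn ℝ 1 f Ω) (hs : tsupport f ⊆ Ω) : ContDiff ℝ 1 f := by
  rw [contDiff_iff_contDiffAt]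
  intro x
  by_cases hx : x ∈ tsupport f
  · exact hf.contDiffAt (hΩ.mem_nhds (hs hx))
  · exact (contDiffAt_const (c := (0 : ℝ))).congr_of_eventuallyEq
      (notMem_tsupport_iff_eventuallyEq.1 hx)

end Calculus

/-! ### The flux of the `p`-Laplacian -/

section Flux

variable {E : Type*} [NormedAddCommGroup E] [InnerProductSpace ℝ E]

/-- The flux `|a|^{p-2} a` of the `p`-Laplacian. For `1 < p` it vanishes at `a = 0`, whatever the
value of `0 ^ (p - 2)`. -/
noncomputable def flux (p : ℝ) (a : E) : E := ‖a‖ ^ (p - 2) • a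

theorem norm_flux {p : ℝ} (hp : 1 < p) (a : E) : ‖flux p a‖ = ‖a‖ ^ (p - 1) := by
  rw [flux, norm_smul, Real.norm_of_nonneg (by positivity)]
  rcases eq_or_ne a 0 with rfl | ha
  · simp [Real.zero_rpow (by linarith : p - 1 ≠ 0)]
  · rw [← Real.rpow_add_one (by simpa using ha)]
    congr 1
    ring

theorem inner_flux_self {p : ℝ} (hp : 1 < p) (a : E) : inner ℝ (flux p a) a = ‖a‖ ^ p := by
  rcases eq_or_ne a 0 with rfl | ha
  · simp [Real.zero_rpow (by linarith : p ≠ 0)]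
  · rw [flux, real_inner_smul_left, real_inner_self_eq_norm_sq, ← Real.rpow_natCast,
      ← Real.rpow_add (by simpa using ha)]
    congr 1
    push_cast
    ring

theorem flux_smul {p t : ℝ} (ht : 0 < t) (a : E) : flux p (t • a) = t ^ (p - 1) • flux p a := by
  rw [flux, flux, norm_smul, Real.norm_of_nonneg ht.le, Real.mul_rpow ht.le (norm_nonneg _),
    smul_smul, smul_smul, mul_right_comm, ← Real.rpow_add_one ht.ne']
  congr 2
  ring_nf

theorem continuous_flux {p : ℝ} (hp : 1 < p) [CompleteSpace E] :
    Continuous (flux p : E → E) := by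
  have h := continuous_gradient (contDiff_norm_rpow (E := E) hp)
  have h2 : ∀ x : E, flux p x = p⁻¹ • ∇ (fun x : E => ‖x‖ ^ p) x := by
    intro x
    have : HasGradientAt (fun x : E => ‖x‖ ^ p) ((p * ‖x‖ ^ (p - 2)) • x) x := by
      rw [hasGradientAt_iff_hasFDerivAt]
      refine (hasFDerivAt_norm_rpow x hp).congr_fderiv ?_
      ext y
      simp
    rw [this.gradient, smul_smul, ← mul_assoc, inv_mul_cancel₀ (by linarith), one_mul, flux]
  rw [show (flux p : E → E) = _ from funext h2]
  exact h.const_smul _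

theorem inner_flux_le {p : ℝ} (hp : 1 < p) (a b : E) :
    inner ℝ (flux p a) b ≤ ‖a‖ ^ (p - 1) * ‖b‖ :=
  (real_inner_le_norm _ _).trans_eq (by rw [norm_flux hp])

/-- Picone's inequality, in the form it takes for the logarithms of two positive functions. It is
the convexity of `|·|^p`. -/
theorem picone {p : ℝ} (hp : 1 < p) (a b : E) :
    0 ≤ ‖a‖ ^ p + (p - 1) * ‖b‖ ^ p - p * inner ℝ (flux p b) a := by
  have h1 := inner_flux_le hp b a
  have hc : p.HolderConjugate (p / (p - 1)) := Real.HolderConjugate.conjExponent hp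
  have h2 := Real.young_inequality_of_nonneg (norm_nonneg a)
    (by positivity : 0 ≤ ‖b‖ ^ (p - 1)) hc
  have hp1 : 0 < p - 1 := by linarith
  rw [← Real.rpow_mul (norm_nonneg _), mul_div_cancel₀ _ hp1.ne'] at h2
  have h3 : p * (‖a‖ * ‖b‖ ^ (p - 1)) ≤ ‖a‖ ^ p + (p - 1) * ‖b‖ ^ p := by
    calc p * (‖a‖ * ‖b‖ ^ (p - 1)) ≤ p * (‖a‖ ^ p / p + ‖b‖ ^ p / (p / (p - 1))) := by gcongr
      _ = _ := by field_simp
  nlinarith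

/-- The flux is monotone, by Picone's inequality applied in both orders. -/
theorem inner_flux_sub_nonneg {p : ℝ} (hp : 1 < p) (a b : E) :
    0 ≤ inner ℝ (flux p a - flux p b) (a - b) := by
  rw [inner_sub_left, inner_sub_right, inner_sub_right, inner_flux_self hp, inner_flux_self hp]
  have h1 := picone hp a b
  have h2 := picone hp b a
  nlinarith

/-- The flux is strictly monotone. -/
theorem eq_of_inner_flux_sub_eq_zero {p : ℝ} (hp : 1 < p) {a b : E}
    (h : inner ℝ (flux p a - flux p b) (a - b) = 0) : a = b := by
  have hp1 : 0 < p - 1 := by linarith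
  have hA := inner_flux_self hp a
  have hB := inner_flux_self hp b
  have hab := inner_flux_le hp a b
  have hba := inner_flux_le hp b a
  have e : ∀ c : E, ‖c‖ ^ p = ‖c‖ ^ (p - 1) * ‖c‖ := fun c => by
    rw [← norm_flux hp, ← inner_flux_self hp]
    rw [flux, real_inner_smul_left, real_inner_self_eq_norm_sq, norm_smul,
      Real.norm_of_nonneg (by positivity)]
    ring
  rw [inner_sub_left, inner_sub_right, inner_sub_right, hA, hB, e, e] at h
  have hn : ‖a‖ = ‖b‖ := by
    rcases lt_trichotomy ‖a‖ ‖b‖ with hl | hl | hl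
    · have := Real.rpow_lt_rpow (norm_nonneg _) hl hp1
      nlinarith
    · exact hl
    · have := Real.rpow_lt_rpow (norm_nonneg _) hl hp1
      nlinarith
  rcases eq_or_ne a 0 with rfl | ha
  · simpa [eq_comm] using hn
  have hpos : 0 < ‖a‖ ^ (p - 2) := Real.rpow_pos_of_pos (by simpa using ha) _
  rw [flux, flux, ← hn, real_inner_smul_left, real_inner_smul_left, real_inner_comm a b] at h
  rw [flux, real_inner_smul_left, real_inner_self_eq_norm_sq, e] at hA
  have h0 : ‖a‖ ^ (p - 2) * (‖a‖ ^ 2 - inner ℝ a b) = 0 := by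
    linarith
  have h1 : ‖a‖ ^ 2 - inner ℝ a b = 0 := by
    rcases mul_eq_zero.1 h0 with h' | h'
    · exact absurd h' hpos.ne'
    · exact h'
  have h2 : ‖a - b‖ ^ 2 = 0 := by
    rw [norm_sub_sq_real, ← hn]
    linarith
  simpa [sub_eq_zero] using h2

end Flux

/-! ### Smooth approximation of test functions -/

section Mollification

variable {E : Type*} [NormedAddCommGroup E] [InnerProductSpace ℝ E] [FiniteDimensional ℝ E]

open scoped Convolution in
/-- A compactly supported `C¹` function is approximated by smooth ones in the `C¹` norm, with
supports in a prescribed neighbourhood of its own support. -/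
theorem exists_contDiff_approx {φ : E → ℝ} (hφ : ContDiff ℝ 1 φ) (hc : HasCompactSupport φ)
    {δ ε : ℝ} (hδ : 0 < δ) (hε : 0 < ε) :
    ∃ ψ : E → ℝ, ContDiff ℝ ∞ ψ ∧ tsupport ψ ⊆ Metric.cthickening δ (tsupport φ) ∧
      ∀ x, |ψ x - φ x| ≤ ε ∧ ‖∇ ψ x - ∇ φ x‖ ≤ ε := by
  borelize E
  have hcd : HasCompactSupport (fderiv ℝ φ) := hc.fderiv ℝ
  have hcont := hφ.continuous_fderiv one_ne_zero
  obtain ⟨r₁, hr₁, h₁⟩ := Metric.uniformContinuous_iff.1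
    (hφ.continuous.uniformContinuous_of_tendsto_cocompact hc.is_zero_at_infty) ε hε
  obtain ⟨r₂, hr₂, h₂⟩ := Metric.uniformContinuous_iff.1
    (hcont.uniformContinuous_of_tendsto_cocompact hcd.is_zero_at_infty) ε hε
  set r := min δ (min r₁ r₂) with hr
  have hr0 : 0 < r := by positivity
  let b : ContDiffBump (0 : E) := ⟨r / 2, r, half_pos hr0, half_lt_self hr0⟩
  let μ : Measure E := volume
  let ψ : E → ℝ := b.normed μ ⋆[ContinuousLinearMap.lsmul ℝ ℝ, μ] φ
  have hfd : ∀ x, fderiv ℝ ψ x =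
      (b.normed μ ⋆[ContinuousLinearMap.lsmul ℝ ℝ, μ] fderiv ℝ φ) x := by
    intro x
    have := HasCompactSupport.hasFDerivAt_convolution_right (ContinuousLinearMap.lsmul ℝ ℝ)
      (μ := μ) hc ((b.continuous_normed (μ := μ)).locallyIntegrable) hφ x
    rw [this.fderiv]
    simp only [convolution]
    congr 1
  refine ⟨ψ, ?_, ?_, fun x => ⟨?_, ?_⟩⟩
  · exact b.hasCompactSupport_normed.contDiff_convolution_left _ b.contDiff_normed
      hφ.continuous.locallyIntegrable
  · refine closure_minimal (fun x hx => ?_) Metric.isClosed_cthickening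
    by_contra h
    have hz : ∀ y ∈ Metric.ball x b.rOut, φ y = 0 := by
      intro y hy
      by_contra hy0
      refine h (Metric.mem_cthickening_of_dist_le x y δ _
        (subset_tsupport φ hy0) ?_)
      rw [dist_comm]
      exact (Metric.mem_ball.1 hy).le.trans (min_le_left _ _)
    have := b.dist_normed_convolution_le (μ := μ) (g := φ) (x₀ := x) (ε := 0)
      hφ.continuous.aestronglyMeasurable (fun y hy => by
        rw [hz y hy, hz x (Metric.mem_ball_self hr0), dist_self])
    rw [hz x (Metric.mem_ball_self hr0)] at this
    exact hx (dist_le_zero.1 this)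
  · rw [← Real.dist_eq]
    refine b.dist_normed_convolution_le hφ.continuous.aestronglyMeasurable fun y hy => ?_
    exact (h₁ ((Metric.mem_ball.1 hy).trans_le
      ((min_le_right _ _).trans (min_le_left _ _)))).le
  · rw [gradient, gradient, ← map_sub, LinearIsometryEquiv.norm_map, ← dist_eq_norm, hfd]
    refine b.dist_normed_convolution_le hcont.aestronglyMeasurable fun y hy => ?_
    exact (h₂ ((Metric.mem_ball.1 hy).trans_le
      ((min_le_right _ _).trans (min_le_right _ _)))).le

end Mollification

/-! ### The equation of the logarithm -/

section TestFunctions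

theorem continuous_mul_of_tsupport_subset {X : Type*} [TopologicalSpace X] {Ω : Set X}
    (hΩ : IsOpen Ω) {F : X → ℝ}
    (hF : ContinuousOn F Ω) {φ : X → ℝ} (hφ : Continuous φ) (hs : tsupport φ ⊆ Ω) :
    Continuous fun x => F x * φ x :=
  continuous_of_continuousOn_of_tsupport_subset hΩ (hF.mul hφ.continuousOn)
    ((tsupport_mul_subset_right).trans hs)

variable {E : Type*} [NormedAddCommGroup E] [InnerProductSpace ℝ E] [FiniteDimensional ℝ E]

theorem continuous_inner_gradient {Ω : Set E} (hΩ : IsOpen Ω) {h : E → E}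
    (hh : ContinuousOn h Ω) {φ : E → ℝ} (hφ : ContDiff ℝ 1 φ) (hs : tsupport φ ⊆ Ω) :
    Continuous fun x => inner ℝ (h x) (∇ φ x) := by
  refine continuous_of_continuousOn_of_tsupport_subset hΩ
    (hh.inner (continuous_gradient hφ).continuousOn) (subset_trans ?_ hs)
  refine subset_trans (closure_mono fun x hx => ?_) (tsupport_gradient_subset φ)
  intro h0
  exact hx (show inner ℝ (h x) (∇ φ x) = 0 by rw [h0, inner_zero_right])

theorem hasCompactSupport_inner_gradient {h : E → E} {φ : E → ℝ} (hc : HasCompactSupport φ) :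
    HasCompactSupport fun x => inner ℝ (h x) (∇ φ x) := by
  refine HasCompactSupport.of_support_subset_isCompact hc fun x hx => ?_
  by_contra h0
  exact hx (show inner ℝ (h x) (∇ φ x) = 0 by
    rw [gradient_eq_zero_of_notMem_tsupport h0, inner_zero_right])

theorem gradient_log {Ω : Set E} (hΩ : IsOpen Ω) {v : E → ℝ} (hv : ContDiffOn ℝ 1 v Ω)
    (hpos : ∀ x ∈ Ω, 0 < v x) {x : E} (hx : x ∈ Ω) :
    ∇ (fun y => Real.log (v y)) x = (v x)⁻¹ • ∇ v x :=
  (hasGradientAt_comp (Real.hasDerivAt_log (hpos x hx).ne')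
    (hasGradientAt_of_contDiffOn hΩ hv hx)).gradient

theorem gradient_comp_linearIsometryEquiv_add (f : E → ℝ) (L : E ≃ₗᵢ[ℝ] E) (c x : E) :
    ∇ (fun y => f (L y + c)) x = L.symm (∇ f (L x + c)) := by
  refine ext_inner_right ℝ fun y => ?_
  rw [inner_gradient_left, LinearIsometryEquiv.inner_map_eq_flip, LinearIsometryEquiv.symm_symm,
    inner_gradient_left]
  have h1 := L.toContinuousLinearEquiv.comp_right_fderiv (f := fun z => f (z + c)) (x := x)
  have h2 : (fun y => f (L y + c)) = (fun z => f (z + c)) ∘ L.toContinuousLinearEquiv := rfl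
  rw [h2, h1, fderiv_comp_add_right]
  rfl

variable [MeasurableSpace E] [BorelSpace E]

theorem integrable_weak_integrand {Ω : Set E} (hΩ : IsOpen Ω) {h : E → E} {F : E → ℝ}
    (hh : ContinuousOn h Ω) (hF : ContinuousOn F Ω) {φ : E → ℝ} (hφ : ContDiff ℝ 1 φ)
    (hc : HasCompactSupport φ) (hs : tsupport φ ⊆ Ω) :
    Integrable (fun x => inner ℝ (h x) (∇ φ x)) ∧ Integrable (fun x => F x * φ x) :=
  ⟨(continuous_inner_gradient hΩ hh hφ hs).integrable_of_hasCompactSupport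
      (hasCompactSupport_inner_gradient hc),
    (continuous_mul_of_tsupport_subset hΩ hF hφ.continuous hs).integrable_of_hasCompactSupport
      hc.mul_left⟩

/-- An identity `div h + F = 0` that holds in the sense of distributions, with continuous `h` and
`F`, may be tested against compactly supported `C¹` functions. -/
theorem weak_identity_of_contDiff_one {Ω : Set E} (hΩ : IsOpen Ω) {h : E → E} {F : E → ℝ}
    (hh : ContinuousOn h Ω) (hF : ContinuousOn F Ω)
    (hw : ∀ φ : E → ℝ, ContDiff ℝ ∞ φ → HasCompactSupport φ → tsupport φ ⊆ Ω →
      ∫ x, inner ℝ (h x) (∇ φ x) = ∫ x, F x * φ x)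
    {φ : E → ℝ} (hφ : ContDiff ℝ 1 φ) (hc : HasCompactSupport φ) (hs : tsupport φ ⊆ Ω) :
    ∫ x, inner ℝ (h x) (∇ φ x) = ∫ x, F x * φ x := by
  obtain ⟨δ, hδ, hδΩ⟩ := hc.isCompact.exists_cthickening_subset_open hΩ hs
  set K := Metric.cthickening δ (tsupport φ) with hK
  have hKc : IsCompact K := hc.isCompact.cthickening
  have hφK : tsupport φ ⊆ K := Metric.self_subset_cthickening _
  obtain ⟨M₁, hM₁⟩ := hKc.exists_bound_of_continuousOn (hh.mono hδΩ)
  obtain ⟨M₂, hM₂⟩ := hKc.exists_bound_of_continuousOn (hF.mono hδΩ)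
  have key : ∀ ε > 0, |(∫ x, inner ℝ (h x) (∇ φ x)) - ∫ x, F x * φ x| ≤
      ε * ((|M₁| + |M₂|) * volume.real K) := by
    intro ε hε
    obtain ⟨ψ, hψ, hψK, hψφ⟩ := exists_contDiff_approx hφ hc hδ hε
    have hψc : HasCompactSupport ψ :=
      HasCompactSupport.of_support_subset_isCompact hKc ((subset_tsupport _).trans hψK)
    have hψ1 : ContDiff ℝ 1 ψ := hψ.of_le (by simp)
    have hz := hw ψ hψ hψc (hψK.trans hδΩ)
    obtain ⟨i1, i2⟩ := integrable_weak_integrand hΩ hh hF hφ hc hs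
    obtain ⟨j1, j2⟩ := integrable_weak_integrand hΩ hh hF hψ1 hψc (hψK.trans hδΩ)
    have e : (∫ x, inner ℝ (h x) (∇ φ x)) - ∫ x, F x * φ x =
        ∫ x in K, ((inner ℝ (h x) (∇ φ x) - inner ℝ (h x) (∇ ψ x)) -
          (F x * φ x - F x * ψ x)) := by
      rw [setIntegral_eq_integral_of_forall_compl_eq_zero]
      · have i3 : ∫ x, ((inner ℝ (h x) (∇ φ x) - inner ℝ (h x) (∇ ψ x)) -
            (F x * φ x - F x * ψ x)) = (∫ x, (inner ℝ (h x) (∇ φ x) - inner ℝ (h x) (∇ ψ x))) -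
            ∫ x, (F x * φ x - F x * ψ x) := integral_sub (i1.sub j1) (i2.sub j2)
        rw [i3, integral_sub i1 j1, integral_sub i2 j2, hz]
        ring
      · intro x hx
        have h1 : x ∉ tsupport φ := fun hh => hx (hφK hh)
        have h2 : x ∉ tsupport ψ := fun hh => hx (hψK hh)
        simp [gradient_eq_zero_of_notMem_tsupport h1, gradient_eq_zero_of_notMem_tsupport h2,
          image_eq_zero_of_notMem_tsupport h1, image_eq_zero_of_notMem_tsupport h2]
    rw [e, ← Real.norm_eq_abs]
    refine (norm_setIntegral_le_of_norm_le_const (C := ε * (|M₁| + |M₂|)) hKc.measure_lt_top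
      fun x hx => ?_).trans_eq (by ring)
    rw [← inner_sub_right, ← mul_sub]
    have b1 := (hM₁ x hx).trans (le_abs_self _)
    have b2 := (hM₂ x hx).trans (le_abs_self _)
    obtain ⟨c1, c2⟩ := hψφ x
    rw [norm_sub_rev] at c2
    rw [abs_sub_comm] at c1
    calc _ ≤ ‖h x‖ * ‖∇ φ x - ∇ ψ x‖ + ‖F x‖ * |φ x - ψ x| := by
          refine (norm_sub_le _ _).trans (add_le_add (norm_inner_le_norm _ _) ?_)
          rw [norm_mul, Real.norm_eq_abs (φ x - ψ x)]
      _ ≤ |M₁| * ε + |M₂| * ε := by gcongr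
      _ = _ := by ring
  have h0 : |(∫ x, inner ℝ (h x) (∇ φ x)) - ∫ x, F x * φ x| ≤ 0 := by
    refine ge_of_tendsto (x := 𝓝[>] (0 : ℝ))
      (f := fun ε => ε * ((|M₁| + |M₂|) * volume.real K)) ?_
      (eventually_mem_nhdsWithin.mono fun ε hε => key ε hε)
    have : Continuous fun ε : ℝ => ε * ((|M₁| + |M₂|) * volume.real K) := by fun_prop
    simpa using (this.tendsto 0).mono_left nhdsWithin_le_nhds
  exact sub_eq_zero.1 (abs_nonpos_iff.1 h0)

/-- `U` solves `-Δ_p U - (p - 1) |∇ U|^p = V` weakly in `Ω`, tested against compactly supported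
`C¹` functions. This is the equation of `U = log v` when `v > 0` and `-Δ_p v = V v^{p-1}`. -/
def IsRiccatiSolution (p : ℝ) (V U : E → ℝ) (Ω : Set E) : Prop :=
  ∀ η : E → ℝ, ContDiff ℝ 1 η → HasCompactSupport η → tsupport η ⊆ Ω →
    ∫ x, (inner ℝ (flux p (∇ U x)) (∇ η x) - ((p - 1) * ‖∇ U x‖ ^ p + V x) * η x) = 0

/-- The equation of the logarithm of a positive solution: test with `φ = v^{1-p} η`. -/
theorem isRiccatiSolution_log {p : ℝ} (hp : 1 < p) {Ω : Set E} (hΩ : IsOpen Ω) {V v : E → ℝ}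
    (hV : ContinuousOn V Ω) (hv : ContDiffOn ℝ 1 v Ω) (hpos : ∀ x ∈ Ω, 0 < v x)
    (hw : ∀ φ : E → ℝ, ContDiff ℝ ∞ φ → HasCompactSupport φ → tsupport φ ⊆ Ω →
      ∫ x, inner ℝ (flux p (∇ v x)) (∇ φ x) = ∫ x, (V x * v x ^ (p - 1)) * φ x) :
    IsRiccatiSolution p V (fun x => Real.log (v x)) Ω := by
  intro η hη hc hs
  have hgv := continuousOn_gradient hΩ hv
  have hh : ContinuousOn (fun x => flux p (∇ v x)) Ω := (continuous_flux hp).comp_continuousOn hgv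
  have hF : ContinuousOn (fun x => V x * v x ^ (p - 1)) Ω :=
    hV.mul (hv.continuousOn.rpow_const fun x hx => Or.inl (hpos x hx).ne')
  set φ : E → ℝ := fun x => v x ^ (1 - p) * η x with hφdef
  have hφs : tsupport φ ⊆ tsupport η := tsupport_mul_subset_right
  have hφ : ContDiff ℝ 1 φ := by
    refine contDiff_of_contDiffOn_of_tsupport_subset hΩ ?_ (hφs.trans hs)
    exact (hv.rpow_const_of_ne fun x hx => (hpos x hx).ne').mul hη.contDiffOn
  have hφc : HasCompactSupport φ := hc.mul_left
  have hmain := weak_identity_of_contDiff_one hΩ hh hF hw hφ hφc (hφs.trans hs)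
  obtain ⟨i1, i2⟩ := integrable_weak_integrand hΩ hh hF hφ hφc (hφs.trans hs)
  rw [← sub_eq_zero, ← integral_sub i1 i2] at hmain
  rw [← hmain]
  congr 1
  ext x
  by_cases hx : x ∈ tsupport η
  · have hxΩ := hs hx
    have hvx := hpos x hxΩ
    have hgφ : ∇ φ x = v x ^ (1 - p) • ∇ η x +
        η x • (((1 - p) * v x ^ (1 - p - 1)) • ∇ v x) :=
      (hasGradientAt_mul (hasGradientAt_comp (Real.hasDerivAt_rpow_const (Or.inl hvx.ne'))
        (hasGradientAt_of_contDiffOn hΩ hv hxΩ)) (hasGradientAt_of_contDiff hη x)).gradient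
    have hgU := gradient_log hΩ hv hpos hxΩ
    have hgv' : ∇ v x = v x • ∇ (fun y => Real.log (v y)) x := by
      rw [hgU, smul_smul, mul_inv_cancel₀ hvx.ne', one_smul]
    rw [hgφ, hgv']
    set G := ∇ (fun y => Real.log (v y)) x
    rw [flux_smul hvx, inner_add_right]
    simp only [real_inner_smul_left, real_inner_smul_right, inner_flux_self hp, hφdef]
    have e1 : v x ^ (p - 1) * v x ^ (1 - p) = 1 := by
      rw [← Real.rpow_add hvx]
      simp
    have e2 : v x ^ (1 - p - 1) * v x = v x ^ (1 - p) := by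
      rw [← Real.rpow_add_one hvx.ne', sub_add_cancel]
    linear_combination (-(inner ℝ (flux p G) (∇ η x)) + (p - 1) * ‖G‖ ^ p * η x
      + V x * η x) * e1 + v x ^ (p - 1) * (p - 1) * ‖G‖ ^ p * η x * e2
  · have hx' : x ∉ tsupport φ := fun h => hx (hφs h)
    simp [gradient_eq_zero_of_notMem_tsupport hx, gradient_eq_zero_of_notMem_tsupport hx',
      image_eq_zero_of_notMem_tsupport hx, image_eq_zero_of_notMem_tsupport hx']

/-- Invariance of the equation under the isometry `x ↦ L x + c`. -/
theorem IsRiccatiSolution.comp_isometry {p : ℝ} {V U : E → ℝ} {Ω : Set E}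
    (h : IsRiccatiSolution p V U Ω) (L : E ≃ₗᵢ[ℝ] E) (c : E) :
    IsRiccatiSolution p (fun x => V (L x + c)) (fun x => U (L x + c))
      ((fun x => L x + c) ⁻¹' Ω) := by
  intro η hη hc hs
  let s : E ≃ₜ E := L.toHomeomorph.trans (Homeomorph.addRight c)
  have hs' : ∀ x, s x = L x + c := fun x => rfl
  have hsymm : ∀ y, s.symm y = L.symm y + L.symm (-c) := fun y => by
    rw [Homeomorph.symm_apply_eq, hs']
    simp
  set θ : E → ℝ := fun y => η (L.symm y + L.symm (-c)) with hθ
  have hθs : θ = η ∘ s.symm := funext fun y => by simp [hθ, hsymm]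
  have hts : tsupport θ = s '' tsupport η := by
    rw [hθs, tsupport_comp_eq_preimage, Homeomorph.image_eq_preimage_symm]
  have hθ1 : ContDiff ℝ 1 θ := hη.comp (L.symm.contDiff.add contDiff_const)
  have hθc : HasCompactSupport θ := by
    rw [HasCompactSupport, hts]
    exact hc.isCompact.image s.continuous
  have hθΩ : tsupport θ ⊆ Ω := by
    rw [hts]
    exact image_subset_iff.2 hs
  have := h θ hθ1 hθc hθΩ
  have hmp : MeasurePreserving (fun x => L x + c) (volume : Measure E) volume :=
    (measurePreserving_add_right volume c).comp L.measurePreserving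
  have hme : MeasurableEmbedding (fun x => L x + c) := s.measurableEmbedding
  rw [← hmp.integral_comp hme] at this
  rw [← this]
  congr 1
  ext x
  have hηθ : η x = θ (L x + c) := by simp [hθ]
  have hηg : ∇ η x = L.symm (∇ θ (L x + c)) := by
    rw [← gradient_comp_linearIsometryEquiv_add]
    congr 1
    ext y
    simp [hθ]
  rw [gradient_comp_linearIsometryEquiv_add, hηg, hηθ]
  simp only [flux, LinearIsometryEquiv.norm_map, ← map_smul, LinearIsometryEquiv.inner_map_map]

end TestFunctions

/-! ### Caccioppoli's inequality -/

section Caccioppoli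

theorem exists_young_const {p : ℝ} (hp : 1 < p) : ∃ C : ℝ, 0 ≤ C ∧ ∀ a b : ℝ, 0 ≤ a → 0 ≤ b →
    p * (a ^ (p - 1) * b) ≤ (p - 1) / 2 * a ^ p + C * b ^ p := by
  have hp1 : 0 < p - 1 := by linarith
  set τ : ℝ := (p - 1) / (2 * p) with hτ
  have hτ0 : 0 < τ := by positivity
  refine ⟨p * (τ⁻¹) ^ (p - 1), by positivity, fun a b ha hb => ?_⟩
  have e : ∀ t : ℝ, 0 ≤ t → t ^ p = t ^ (p - 1) * t := fun t ht => by
    rw [← Real.rpow_add_one' ht (by linarith), sub_add_cancel]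
  have hap : 0 ≤ a ^ p := by positivity
  have hbp : 0 ≤ b ^ p := by positivity
  -- compare `b` with `τ a`
  rcases le_total b (τ * a) with h | h
  · have h1 : p * (a ^ (p - 1) * b) ≤ p * (a ^ (p - 1) * (τ * a)) := by gcongr
    have h2 : p * (a ^ (p - 1) * (τ * a)) = (p - 1) / 2 * a ^ p := by
      rw [e a ha, hτ]
      field_simp
    have : 0 ≤ p * (τ⁻¹) ^ (p - 1) * b ^ p := by positivity
    linarith
  · have h1 : a ≤ τ⁻¹ * b := by
      rw [inv_mul_eq_div, le_div_iff₀ hτ0]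
      linarith
    have h2 : a ^ (p - 1) ≤ (τ⁻¹) ^ (p - 1) * b ^ (p - 1) := by
      rw [← Real.mul_rpow (by positivity) hb]
      exact Real.rpow_le_rpow ha h1 hp1.le
    have h3 : p * (a ^ (p - 1) * b) ≤ p * ((τ⁻¹) ^ (p - 1) * b ^ (p - 1) * b) := by gcongr
    rw [e b hb]
    have : 0 ≤ (p - 1) / 2 * a ^ p := by positivity
    linarith

theorem support_rpow_subset {X : Type*} {ζ : X → ℝ} {p : ℝ} (hp : p ≠ 0) :
    Function.support (fun x => ζ x ^ p) ⊆ Function.support ζ := fun x hx h0 => hx (by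
  simp [h0, Real.zero_rpow hp])

variable {E : Type*} [NormedAddCommGroup E] [InnerProductSpace ℝ E] [FiniteDimensional ℝ E]

theorem continuousOn_norm_gradient_rpow {Ω : Set E} (hΩ : IsOpen Ω) {U : E → ℝ}
    (hU : ContDiffOn ℝ 1 U Ω) {q : ℝ} (hq : 0 ≤ q) :
    ContinuousOn (fun x => ‖∇ U x‖ ^ q) Ω :=
  (continuousOn_gradient hΩ hU).norm.rpow_const fun _ _ => Or.inr hq

variable [MeasurableSpace E] [BorelSpace E]

theorem integrable_riccati_integrand {p : ℝ} (hp : 1 < p) {Ω : Set E} (hΩ : IsOpen Ω)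
    {V U : E → ℝ} (hV : ContinuousOn V Ω) (hU : ContDiffOn ℝ 1 U Ω) {η : E → ℝ}
    (hη : ContDiff ℝ 1 η) (hc : HasCompactSupport η) (hs : tsupport η ⊆ Ω) :
    Integrable fun x =>
      inner ℝ (flux p (∇ U x)) (∇ η x) - ((p - 1) * ‖∇ U x‖ ^ p + V x) * η x := by
  obtain ⟨h1, h2⟩ := integrable_weak_integrand hΩ
    ((continuous_flux hp).comp_continuousOn (continuousOn_gradient hΩ hU))
    (((continuousOn_norm_gradient_rpow hΩ hU (by linarith : 0 ≤ p)).const_mul (p - 1)).add hV)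
    hη hc hs
  exact h1.sub h2

theorem integrable_norm_gradient_rpow {p : ℝ} (hp : 1 < p) {ζ : E → ℝ} (hζ : ContDiff ℝ 1 ζ)
    (hc : HasCompactSupport ζ) : Integrable fun x => ‖∇ ζ x‖ ^ p := by
  have hp0 : p ≠ 0 := by linarith
  refine Continuous.integrable_of_hasCompactSupport
    ((continuous_gradient hζ).norm.rpow_const fun _ => Or.inr (by linarith)) ?_
  refine HasCompactSupport.of_support_subset_isCompact hc fun x hx => ?_
  by_contra h0
  refine hx ?_
  simp [gradient_eq_zero_of_notMem_tsupport h0, Real.zero_rpow hp0]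

theorem integrable_gradient_rpow_mul {p : ℝ} (hp : 1 < p) {Ω : Set E} (hΩ : IsOpen Ω)
    {U : E → ℝ} (hU : ContDiffOn ℝ 1 U Ω) {ζ : E → ℝ} (hζ : ContDiff ℝ 1 ζ)
    (hc : HasCompactSupport ζ) (hs : tsupport ζ ⊆ Ω) :
    Integrable fun x => ‖∇ U x‖ ^ p * ζ x ^ p := by
  have hsub := support_rpow_subset (ζ := ζ) (by linarith : p ≠ 0)
  exact (continuous_mul_of_tsupport_subset hΩ
    (continuousOn_norm_gradient_rpow hΩ hU (by linarith : 0 ≤ p))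
    (hζ.continuous.rpow_const fun _ => Or.inr (by linarith))
    ((closure_mono hsub).trans hs)).integrable_of_hasCompactSupport
      (HasCompactSupport.mul_left (hc.mono hsub))

/-- Caccioppoli's inequality in logarithmic form, with a constant that depends only on `p`. It is
obtained by testing with `ζ ^ p`. -/
theorem exists_caccioppoli {p : ℝ} (hp : 1 < p) : ∃ C : ℝ, 0 ≤ C ∧
    ∀ (Ω : Set E) (V U ζ : E → ℝ), IsOpen Ω → ContinuousOn V Ω → (∀ x ∈ Ω, 0 ≤ V x) →
      ContDiffOn ℝ 1 U Ω → IsRiccatiSolution p V U Ω → ContDiff ℝ 1 ζ → HasCompactSupport ζ →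
      tsupport ζ ⊆ Ω → (∀ x, 0 ≤ ζ x) →
      ∫ x, ‖∇ U x‖ ^ p * ζ x ^ p ≤ C * ∫ x, ‖∇ ζ x‖ ^ p := by
  obtain ⟨C, hC, hY⟩ := exists_young_const hp
  have hp1 : 0 < p - 1 := by linarith
  refine ⟨2 / (p - 1) * C, by positivity, ?_⟩
  intro Ω V U ζ hΩ hV hV0 hU hR hζ hc hs hζ0
  set η : E → ℝ := fun x => ζ x ^ p with hη
  have hη1 : ContDiff ℝ 1 η := hζ.rpow_const_of_le (by simpa using hp.le)
  have hsub : Function.support η ⊆ Function.support ζ := support_rpow_subset (by linarith)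
  have hηs : tsupport η ⊆ tsupport ζ := closure_mono hsub
  have hηc : HasCompactSupport η := hc.mono hsub
  have hI := hR η hη1 hηc (hηs.trans hs)
  have iI := integrable_riccati_integrand hp hΩ hV hU hη1 hηc (hηs.trans hs)
  have iG := integrable_gradient_rpow_mul hp hΩ hU hζ hc hs
  have iζ := integrable_norm_gradient_rpow hp hζ hc
  have hpt : ∀ x, (p - 1) / 2 * (‖∇ U x‖ ^ p * ζ x ^ p) ≤ C * ‖∇ ζ x‖ ^ p -
      (inner ℝ (flux p (∇ U x)) (∇ η x) - ((p - 1) * ‖∇ U x‖ ^ p + V x) * η x) := by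
    intro x
    have hgη : ∇ η x = (p * ζ x ^ (p - 1)) • ∇ ζ x :=
      (hasGradientAt_comp (Real.hasDerivAt_rpow_const (Or.inr hp.le))
        (hasGradientAt_of_contDiff hζ x)).gradient
    have hVη : 0 ≤ V x * η x := by
      by_cases hx : x ∈ Ω
      · exact mul_nonneg (hV0 x hx) (Real.rpow_nonneg (hζ0 x) _)
      · rw [image_eq_zero_of_notMem_tsupport fun h => hx (hs (hηs h)), mul_zero]
    have h1 := inner_flux_le hp (∇ U x) (∇ η x)
    have h2 := hY (‖∇ U x‖ * ζ x) ‖∇ ζ x‖ (mul_nonneg (norm_nonneg _) (hζ0 x)) (norm_nonneg _)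
    rw [Real.mul_rpow (norm_nonneg _) (hζ0 x), Real.mul_rpow (norm_nonneg _) (hζ0 x)] at h2
    have h3 : ‖∇ η x‖ = p * ζ x ^ (p - 1) * ‖∇ ζ x‖ := by
      rw [hgη, norm_smul, Real.norm_of_nonneg
        (mul_nonneg (by linarith) (Real.rpow_nonneg (hζ0 x) _))]
    rw [h3] at h1
    have h4 : η x = ζ x ^ p := rfl
    rw [h4] at hVη ⊢
    linarith
  have hint := integral_mono (iG.const_mul ((p - 1) / 2)) ((iζ.const_mul C).sub iI) hpt
  have e : ∫ x, (C * ‖∇ ζ x‖ ^ p - (inner ℝ (flux p (∇ U x)) (∇ η x) -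
      ((p - 1) * ‖∇ U x‖ ^ p + V x) * η x)) = C * ∫ x, ‖∇ ζ x‖ ^ p := by
    rw [integral_sub (iζ.const_mul C) iI, hI, sub_zero, integral_const_mul]
  simp only [Pi.sub_apply] at hint
  rw [e, integral_const_mul] at hint
  rw [mul_assoc, div_mul_eq_mul_div, le_div_iff₀ hp1]
  linarith

end Caccioppoli

/-! ### Comparison of two solutions -/

section Comparison

variable {E : Type*} [NormedAddCommGroup E] [InnerProductSpace ℝ E] [FiniteDimensional ℝ E]
  [MeasurableSpace E] [BorelSpace E]

/-- The comparison argument. Two solutions `U`, `W` with ordered potentials are tested with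
`exp (p U) K ψ`, where `K` is a nondecreasing function of `U - W` and `ψ` a cutoff at infinity;
Picone's inequality and the monotonicity of the flux force `∇ K = 0`. -/
theorem gradient_eq_zero_of_comparison {p : ℝ} (hp : 1 < p) {Ω : Set E} (hΩ : IsOpen Ω)
    {V₁ V₂ U W K : E → ℝ} (hV₁ : ContinuousOn V₁ Ω) (hV₂ : ContinuousOn V₂ Ω)
    (hU : ContDiffOn ℝ 1 U Ω) (hW : ContDiffOn ℝ 1 W Ω)
    (h₁ : IsRiccatiSolution p V₁ U Ω) (h₂ : IsRiccatiSolution p V₂ W Ω)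
    (hK : ContDiff ℝ 1 K) (hKΩ : tsupport K ⊆ Ω) (hK0 : ∀ x, 0 ≤ K x)
    (hKV : ∀ x, K x ≠ 0 → V₁ x ≤ V₂ x)
    (hgrad : ∀ x, ∃ k : ℝ, 0 ≤ k ∧ ∇ K x = k • (∇ U x - ∇ W x))
    (hcut : ∀ ρ : ℝ, ∀ ε > 0, ∃ ψ : E → ℝ, ContDiff ℝ 1 ψ ∧ HasCompactSupport ψ ∧
      (∀ x, 0 ≤ ψ x) ∧ (∀ x, ‖x‖ ≤ ρ → 1 ≤ ψ x) ∧
      ∫ x, Real.exp (p * U x) * ((‖∇ U x‖ ^ (p - 1) + ‖∇ W x‖ ^ (p - 1)) * ‖∇ ψ x‖) * K x ≤ ε)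
    (x : E) : ∇ K x = 0 := by
  have hp1 : 0 ≤ p - 1 := by linarith
  have hgU := continuousOn_gradient hΩ hU
  have hgW := continuousOn_gradient hΩ hW
  have hexp : ContinuousOn (fun x => Real.exp (p * U x)) Ω :=
    Real.continuous_exp.comp_continuousOn (hU.continuousOn.const_mul p)
  set S : E → E := fun x => flux p (∇ U x) - flux p (∇ W x) with hS
  have hSc : ContinuousOn S Ω := ((continuous_flux hp).comp_continuousOn hgU).sub
    ((continuous_flux hp).comp_continuousOn hgW)
  set Q : E → ℝ := fun x => inner ℝ (Real.exp (p * U x) • S x) (∇ K x) with hQ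
  have hQc : Continuous Q := continuous_inner_gradient hΩ (hexp.smul hSc) hK hKΩ
  have hQ0 : ∀ x, 0 ≤ Q x := by
    intro x
    obtain ⟨k, hk, hkx⟩ := hgrad x
    have := inner_flux_sub_nonneg hp (∇ U x) (∇ W x)
    simp only [hQ, hS, hkx, real_inner_smul_left, real_inner_smul_right]
    positivity
  have key : ∀ ρ : ℝ, ∀ ψ₀ : E → ℝ, Continuous ψ₀ → HasCompactSupport ψ₀ →
      (∀ x, ψ₀ x ≤ 1) → tsupport ψ₀ ⊆ Metric.closedBall 0 ρ → ∀ ε > 0,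
      ∫ x, Q x * ψ₀ x ≤ ε := by
    intro ρ ψ₀ hψ₀ hψ₀c hψ₀1 hψ₀ρ ε hε
    obtain ⟨ψ, hψ, hψc, hψ0, hψ1, herr⟩ := hcut ρ ε hε
    set η : E → ℝ := fun x => Real.exp (p * U x) * (K x * ψ x) with hη
    have hηK : tsupport η ⊆ tsupport K :=
      (tsupport_mul_subset_right).trans tsupport_mul_subset_left
    have hη1 : ContDiff ℝ 1 η := contDiff_of_contDiffOn_of_tsupport_subset hΩ
      ((Real.contDiff_exp.comp_contDiffOn (contDiffOn_const.mul hU)).mul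
        (hK.mul hψ).contDiffOn) (hηK.trans hKΩ)
    have hηc : HasCompactSupport η := (hψc.mul_left).mul_left
    have hηΩ := hηK.trans hKΩ
    have e₁ := h₁ η hη1 hηc hηΩ
    have e₂ := h₂ η hη1 hηc hηΩ
    have i₁ := integrable_riccati_integrand hp hΩ hV₁ hU hη1 hηc hηΩ
    have i₂ := integrable_riccati_integrand hp hΩ hV₂ hW hη1 hηc hηΩ
    have iQ : Integrable fun x => Q x * ψ₀ x :=
      (hQc.mul hψ₀).integrable_of_hasCompactSupport hψ₀c.mul_left
    set err : E → ℝ := fun x => Real.exp (p * U x) *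
      ((‖∇ U x‖ ^ (p - 1) + ‖∇ W x‖ ^ (p - 1)) * ‖∇ ψ x‖) * K x with herrdef
    have ierr : Integrable err := by
      refine Continuous.integrable_of_hasCompactSupport
        (continuous_mul_of_tsupport_subset hΩ (hexp.mul
          (((continuousOn_norm_gradient_rpow hΩ hU hp1).add
            (continuousOn_norm_gradient_rpow hΩ hW hp1)).mul
              (continuous_gradient hψ).norm.continuousOn)) hK.continuous hKΩ) ?_
      refine HasCompactSupport.of_support_subset_isCompact hψc fun x hx => ?_
      by_contra h0
      refine hx (?_ : err x = 0)
      simp only [herrdef, gradient_eq_zero_of_notMem_tsupport h0, norm_zero, mul_zero, zero_mul]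
    have hpt : ∀ x, Q x * ψ₀ x ≤
        (inner ℝ (flux p (∇ U x)) (∇ η x) - ((p - 1) * ‖∇ U x‖ ^ p + V₁ x) * η x) -
        (inner ℝ (flux p (∇ W x)) (∇ η x) - ((p - 1) * ‖∇ W x‖ ^ p + V₂ x) * η x) + err x := by
      intro x
      have hψle : Q x * ψ₀ x ≤ Q x * ψ x := by
        by_cases hx : x ∈ tsupport ψ₀
        · exact mul_le_mul_of_nonneg_left ((hψ₀1 x).trans
            (hψ1 x (by simpa using hψ₀ρ hx))) (hQ0 x)
        · rw [image_eq_zero_of_notMem_tsupport hx, mul_zero]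
          exact mul_nonneg (hQ0 x) (hψ0 x)
      refine hψle.trans ?_
      by_cases hx : x ∈ tsupport K
      · have hxΩ := hKΩ hx
        have hgη : ∇ η x = Real.exp (p * U x) • (K x • ∇ ψ x + ψ x • ∇ K x) +
            (K x * ψ x) • ((Real.exp (p * U x) * p) • ∇ U x) := by
          have hd : HasDerivAt (fun t => Real.exp (p * t)) (Real.exp (p * U x) * p) (U x) := by
            simpa using ((hasDerivAt_id (U x)).const_mul p).exp
          exact (hasGradientAt_mul
            (hasGradientAt_comp hd (hasGradientAt_of_contDiffOn hΩ hU hxΩ))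
            (hasGradientAt_mul (hasGradientAt_of_contDiff hK x)
              (hasGradientAt_of_contDiff hψ x))).gradient
        have hpic := picone hp (∇ U x) (∇ W x)
        have hV : 0 ≤ (V₂ x - V₁ x) * K x := by
          by_cases hKx : K x = 0
          · simp [hKx]
          · exact mul_nonneg (sub_nonneg.2 (hKV x hKx)) (hK0 x)
        have hSψ : -((‖∇ U x‖ ^ (p - 1) + ‖∇ W x‖ ^ (p - 1)) * ‖∇ ψ x‖) ≤
            inner ℝ (flux p (∇ U x)) (∇ ψ x) - inner ℝ (flux p (∇ W x)) (∇ ψ x) := by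
          have h1 := inner_flux_le hp (∇ W x) (∇ ψ x)
          have h2 := inner_flux_le hp (∇ U x) (-∇ ψ x)
          rw [inner_neg_right, norm_neg] at h2
          linarith
        have he := (Real.exp_pos (p * U x)).le
        have n1 := mul_nonneg (mul_nonneg (mul_nonneg he (hK0 x)) (hψ0 x)) hpic
        have n2 := mul_nonneg (mul_nonneg he (hψ0 x)) hV
        have n3 := mul_le_mul_of_nonneg_left hSψ (mul_nonneg he (hK0 x))
        have hUU := inner_flux_self hp (∇ U x)
        rw [hgη]
        simp only [hQ, hS, herrdef, hη, inner_add_right, real_inner_smul_left,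
          real_inner_smul_right, inner_sub_left, hUU]
        linarith
      · have hx' : x ∉ tsupport η := fun h => hx (hηK h)
        simp only [hQ, herrdef, gradient_eq_zero_of_notMem_tsupport hx,
          gradient_eq_zero_of_notMem_tsupport hx', image_eq_zero_of_notMem_tsupport hx,
          image_eq_zero_of_notMem_tsupport hx', inner_zero_right, zero_mul, mul_zero, sub_self,
          add_zero, le_refl]
    have hint := integral_mono iQ ((i₁.sub i₂).add ierr) hpt
    simp only [Pi.sub_apply, Pi.add_apply] at hint
    have e : ∫ x, ((inner ℝ (flux p (∇ U x)) (∇ η x) - ((p - 1) * ‖∇ U x‖ ^ p + V₁ x) * η x) -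
        (inner ℝ (flux p (∇ W x)) (∇ η x) - ((p - 1) * ‖∇ W x‖ ^ p + V₂ x) * η x) + err x) =
        ∫ x, err x := by
      have := integral_add (i₁.sub i₂) ierr
      simp only [Pi.sub_apply] at this
      rw [this, integral_sub i₁ i₂, e₁, e₂]
      simp
    rw [e] at hint
    exact hint.trans herr
  have hQx : Q x = 0 := by
    let b : ContDiffBump x := ⟨1, 2, one_pos, one_lt_two⟩
    by_contra hne
    have hpos : 0 < ∫ y, Q y * b y :=
      Continuous.integral_pos_of_hasCompactSupport_nonneg_nonzero
        (hQc.mul b.continuous) b.hasCompactSupport.mul_left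
        (fun y => mul_nonneg (hQ0 y) b.nonneg)
        (x := x) (by
          rw [b.one_of_mem_closedBall (Metric.mem_closedBall_self b.rIn_pos.le), mul_one]
          exact hne)
    have hle := key (‖x‖ + 2) b b.continuous b.hasCompactSupport
      (fun y => b.le_one) (by
        rw [b.tsupport_eq]
        intro y hy
        rw [mem_closedBall_zero_iff]
        have h1 : ‖y - x‖ ≤ 2 := by simpa [dist_eq_norm] using hy
        have h2 := norm_sub_norm_le y x
        linarith) _ (half_pos hpos)
    linarith
  obtain ⟨k, hk, hkx⟩ := hgrad x
  simp only [hQ, hS, hkx, real_inner_smul_left, real_inner_smul_right] at hQx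
  rcases mul_eq_zero.1 hQx with h | h
  · exact absurd h (Real.exp_pos _).ne'
  · rcases mul_eq_zero.1 h with h | h
    · rw [hkx, h, zero_smul]
    · rw [hkx, eq_of_inner_flux_sub_eq_zero hp h, sub_self, smul_zero]

end Comparison

/-! ### Cutoff at infinity -/

section Cutoff

theorem rpow_sub_one_mul_le {p a b : ℝ} (hp : 1 < p) (ha : 0 ≤ a) (hb : 0 ≤ b) :
    a ^ (p - 1) * b ≤ a ^ p + b ^ p := by
  have e : ∀ t : ℝ, 0 ≤ t → t ^ p = t ^ (p - 1) * t := fun t ht => by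
    rw [← Real.rpow_add_one' ht (by linarith), sub_add_cancel]
  have hap : 0 ≤ a ^ p := by positivity
  have hbp : 0 ≤ b ^ p := by positivity
  rcases le_total a b with h | h
  · have : a ^ (p - 1) * b ≤ b ^ (p - 1) * b := by
      gcongr
    linarith [e b hb]
  · have : a ^ (p - 1) * b ≤ a ^ (p - 1) * a := by gcongr
    linarith [e a ha]

variable {E : Type*} [NormedAddCommGroup E] [InnerProductSpace ℝ E] [FiniteDimensional ℝ E]

theorem gradient_comp_smul {f : E → ℝ} (hf : ContDiff ℝ 1 f) (t : ℝ) (x : E) :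
    ∇ (fun y => f (t • y)) x = t • ∇ f (t • x) := by
  refine HasGradientAt.gradient ?_
  rw [hasGradientAt_iff_hasFDerivAt]
  have h1 := (hasGradientAt_of_contDiff hf (t • x)).hasFDerivAt
  refine (h1.comp x ((hasFDerivAt_id x).const_smul t)).congr_fderiv ?_
  ext y
  simp

theorem exists_annular_bump : ∃ ζ : E → ℝ, ContDiff ℝ 1 ζ ∧ HasCompactSupport ζ ∧
    (∀ x, 0 ≤ ζ x) ∧ (∀ x, 1 ≤ ‖x‖ → ‖x‖ ≤ 2 → ζ x = 1) ∧
    ∀ x ∈ tsupport ζ, 1 / 2 ≤ ‖x‖ := by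
  let b₀ : ContDiffBump (0 : E) := ⟨1 / 2, 1, by norm_num, by norm_num⟩
  let b₁ : ContDiffBump (0 : E) := ⟨2, 3, by norm_num, by norm_num⟩
  refine ⟨fun x => b₁ x * (1 - b₀ x), b₁.contDiff.mul (contDiff_const.sub b₀.contDiff),
    b₁.hasCompactSupport.mul_right, fun x => mul_nonneg b₁.nonneg (sub_nonneg.2 b₀.le_one),
    fun x h1 h2 => ?_, fun x hx => ?_⟩
  · have e1 : b₁ x = 1 := b₁.one_of_mem_closedBall (by simpa using h2)
    have e0 : b₀ x = 0 := b₀.zero_of_le_dist (by simpa using h1)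
    simp only [e1, e0]
    norm_num
  · have hcl : IsClosed {x : E | 1 / 2 ≤ ‖x‖} := isClosed_le continuous_const continuous_norm
    refine closure_minimal (fun y hy => ?_) hcl hx
    by_contra hlt
    refine hy ?_
    have e0 : b₀ y = 1 := b₀.one_of_mem_closedBall (by
      simpa using (not_le.1 hlt).le)
    simp [e0]

variable [MeasurableSpace E] [BorelSpace E]

theorem IsRiccatiSolution.mono {p : ℝ} {V U : E → ℝ} {Ω Ω' : Set E}
    (h : IsRiccatiSolution p V U Ω) (hΩ : Ω' ⊆ Ω) : IsRiccatiSolution p V U Ω' :=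
  fun η h1 h2 h3 => h η h1 h2 (h3.trans hΩ)

/-- Decay of `exp U` faster than `|x|^{-(N-p)/p}` makes the error produced by a cutoff at infinity
negligible. The gradients on the annulus where the cutoff varies are controlled by Caccioppoli's
inequality. -/
theorem exists_cutoff {p : ℝ} (hp : 1 < p) {Ω : Set E} (hΩ : IsOpen Ω)
    {V₁ V₂ U W K : E → ℝ} (hV₁ : ContinuousOn V₁ Ω) (hV₂ : ContinuousOn V₂ Ω)
    (hV₁0 : ∀ x ∈ Ω, 0 ≤ V₁ x) (hV₂0 : ∀ x ∈ Ω, 0 ≤ V₂ x)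
    (hU : ContDiffOn ℝ 1 U Ω) (hW : ContDiffOn ℝ 1 W Ω)
    (h₁ : IsRiccatiSolution p V₁ U Ω) (h₂ : IsRiccatiSolution p V₂ W Ω)
    (hK0 : ∀ x, 0 ≤ K x) (hK1 : ∀ x, K x ≤ 1)
    {R C g : ℝ} (hC : 0 ≤ C) (hg : 0 ≤ g) (hΩR : ∀ x, R < ‖x‖ → x ∈ Ω)
    (hdec : ∀ x, R < ‖x‖ → Real.exp (U x) ≤ C * ‖x‖ ^ (-g))
    (hgp : Module.finrank ℝ E - p < g * p) (ρ : ℝ) {ε : ℝ} (hε : 0 < ε) :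
    ∃ ψ : E → ℝ, ContDiff ℝ 1 ψ ∧ HasCompactSupport ψ ∧
      (∀ x, 0 ≤ ψ x) ∧ (∀ x, ‖x‖ ≤ ρ → 1 ≤ ψ x) ∧
      ∫ x, Real.exp (p * U x) *
        ((‖∇ U x‖ ^ (p - 1) + ‖∇ W x‖ ^ (p - 1)) * ‖∇ ψ x‖) * K x ≤ ε := by
  obtain ⟨ζ, hζ, hζc, hζ0, hζ1, hζs⟩ := exists_annular_bump (E := E)
  obtain ⟨CC, hCC, hcac⟩ := exists_caccioppoli (E := E) hp
  let χ : ContDiffBump (0 : E) := ⟨1, 2, by norm_num, by norm_num⟩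
  have hχ : ContDiff ℝ 1 χ := χ.contDiff
  obtain ⟨M, hM⟩ : ∃ M, ∀ x, ‖∇ (χ : E → ℝ) x‖ ≤ M :=
    (continuous_gradient hχ).bounded_above_of_compact_support
      (HasCompactSupport.of_support_subset_isCompact χ.hasCompactSupport
        ((subset_tsupport _).trans (tsupport_gradient_subset _)))
  have hM0 : 0 ≤ M := (norm_nonneg _).trans (hM 0)
  set d := Module.finrank ℝ E with hd
  set I₀ := ∫ x, ζ x ^ p with hI₀
  set I₁ := ∫ x, ‖∇ ζ x‖ ^ p with hI₁
  set A := C ^ p * M * (2 * CC * I₁ + 2 * I₀) with hA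
  have hlim : Tendsto (fun r : ℝ => A * r ^ (-(g * p - (d - p)))) atTop (𝓝 0) := by
    simpa using (tendsto_rpow_neg_atTop (by linarith : 0 < g * p - (d - p))).const_mul A
  obtain ⟨r, hr1, hrR, hrρ, hrε⟩ := ((eventually_gt_atTop (0 : ℝ)).and
    ((eventually_gt_atTop (2 * R)).and ((eventually_ge_atTop ρ).and
      (hlim.eventually (gt_mem_nhds hε))))).exists
  have hp0 : 0 ≤ p := by linarith
  have hnorm : ∀ x : E, ‖r⁻¹ • x‖ = ‖x‖ / r := fun x => by
    rw [norm_smul, Real.norm_of_nonneg (by positivity), inv_mul_eq_div]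
  let e : E ≃ₜ E := Homeomorph.smulOfNeZero r⁻¹ (inv_ne_zero hr1.ne')
  have hscale : ∀ f : E → ℝ, HasCompactSupport f → HasCompactSupport fun x => f (r⁻¹ • x) :=
    fun f hf => hf.comp_homeomorph e
  have hsm : ContDiff ℝ 1 fun x : E => r⁻¹ • x := contDiff_id.const_smul _
  set ψ : E → ℝ := fun x => χ (r⁻¹ • x) with hψ
  set ζr : E → ℝ := fun x => ζ (r⁻¹ • x) with hζr
  have hζr1 : ContDiff ℝ 1 ζr := hζ.comp hsm
  have hζrc : HasCompactSupport ζr := hscale ζ hζc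
  have hζrs : tsupport ζr ⊆ Ω := by
    intro x hx
    have hx' : r⁻¹ • x ∈ tsupport ζ := by
      have := tsupport_comp_eq_preimage ζ e
      have h2 : x ∈ tsupport (ζ ∘ e) := hx
      rw [this] at h2
      exact h2
    have := hζs _ hx'
    rw [hnorm, le_div_iff₀ hr1] at this
    exact hΩR x (by linarith)
  have hζr0 : ∀ x, 0 ≤ ζr x := fun x => hζ0 _
  have hgψ : ∀ x, ‖∇ ψ x‖ ≤ M * r⁻¹ := fun x => by
    rw [hψ, gradient_comp_smul hχ, norm_smul, Real.norm_of_nonneg (by positivity), mul_comm]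
    have := hM (r⁻¹ • x)
    gcongr
  have hgζ : ∫ x, ‖∇ ζr x‖ ^ p = r ^ (d - p) * I₁ := by
    have h1 : ∀ x, ‖∇ ζr x‖ ^ p = r ^ (-p) * ‖∇ ζ (r⁻¹ • x)‖ ^ p := fun x => by
      rw [hζr, gradient_comp_smul hζ, norm_smul, Real.norm_of_nonneg (by positivity),
        Real.mul_rpow (by positivity) (norm_nonneg _), Real.inv_rpow hr1.le,
        Real.rpow_neg hr1.le]
    simp_rw [h1]
    rw [integral_const_mul,
      Measure.integral_comp_inv_smul_of_nonneg volume (fun x => ‖∇ ζ x‖ ^ p) hr1.le, smul_eq_mul,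
      ← mul_assoc, ← Real.rpow_natCast, ← Real.rpow_add hr1]
    congr 2
    ring
  have hiζ : ∫ x, ζr x ^ p = r ^ (d : ℝ) * I₀ := by
    rw [hζr, Measure.integral_comp_inv_smul_of_nonneg volume (fun x => ζ x ^ p) hr1.le,
      smul_eq_mul, ← Real.rpow_natCast]
  have hcU := hcac Ω V₁ U ζr hΩ hV₁ hV₁0 hU h₁ hζr1 hζrc hζrs hζr0
  have hcW := hcac Ω V₂ W ζr hΩ hV₂ hV₂0 hW h₂ hζr1 hζrc hζrs hζr0
  have iU := integrable_gradient_rpow_mul hp hΩ hU hζr1 hζrc hζrs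
  have iW := integrable_gradient_rpow_mul hp hΩ hW hζr1 hζrc hζrs
  have iζ : Integrable fun x => ζr x ^ p :=
    (hζr1.continuous.rpow_const fun _ => Or.inr hp0).integrable_of_hasCompactSupport
      (hζrc.mono (support_rpow_subset (by linarith)))
  refine ⟨ψ, hχ.comp hsm, hscale χ χ.hasCompactSupport, fun x => χ.nonneg, fun x hx => ?_, ?_⟩
  · refine (χ.one_of_mem_closedBall ?_).ge
    rw [mem_closedBall_zero_iff, hnorm]
    exact (div_le_one hr1).2 (hx.trans hrρ)
  set B := (C * r ^ (-g)) ^ p * M with hB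
  have hB0 : 0 ≤ B := by positivity
  have hpt : ∀ x, Real.exp (p * U x) *
      ((‖∇ U x‖ ^ (p - 1) + ‖∇ W x‖ ^ (p - 1)) * ‖∇ ψ x‖) * K x ≤
      B * ((‖∇ U x‖ ^ p * ζr x ^ p + ‖∇ W x‖ ^ p * ζr x ^ p) + 2 * r ^ (-p) * ζr x ^ p) := by
    intro x
    have hrhs : 0 ≤ B * ((‖∇ U x‖ ^ p * ζr x ^ p + ‖∇ W x‖ ^ p * ζr x ^ p) +
        2 * r ^ (-p) * ζr x ^ p) := by
      have := hζr0 x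
      positivity
    by_cases hx0 : ∇ ψ x = 0
    · rw [hx0, norm_zero, mul_zero, mul_zero, zero_mul]
      exact hrhs
    have hge : 1 ≤ ‖r⁻¹ • x‖ := by
      by_contra hlt
      rw [not_le] at hlt
      refine hx0 ?_
      rw [hψ, gradient_comp_smul hχ, (χ.eventuallyEq_one_of_mem_ball
        (by simpa using hlt)).gradient_eq]
      simp [gradient]
    have hle : ‖r⁻¹ • x‖ ≤ 2 := by
      by_contra hlt
      refine hx0 ?_
      rw [hψ, gradient_comp_smul hχ, gradient_eq_zero_of_notMem_tsupport, smul_zero]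
      rw [χ.tsupport_eq, mem_closedBall_zero_iff]
      exact hlt
    have hζx : ζr x = 1 := hζ1 _ hge hle
    rw [hnorm, le_div_iff₀ hr1, one_mul] at hge
    have hexp : Real.exp (p * U x) ≤ (C * r ^ (-g)) ^ p := by
      have hRx : R < ‖x‖ := by
        rcases le_total 0 R with h | h
        · linarith
        · linarith
      have h1 : Real.exp (U x) ≤ C * r ^ (-g) := by
        refine (hdec x hRx).trans ?_
        have := Real.rpow_le_rpow_of_nonpos hr1 hge (by linarith : -g ≤ 0)
        gcongr
      rw [mul_comm, Real.exp_mul]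
      exact Real.rpow_le_rpow (Real.exp_pos _).le h1 hp0
    have hrp : (r⁻¹) ^ p = r ^ (-p) := by
      rw [Real.inv_rpow hr1.le, Real.rpow_neg hr1.le]
    have y1 := rpow_sub_one_mul_le hp (norm_nonneg (∇ U x)) (inv_nonneg.2 hr1.le)
    have y2 := rpow_sub_one_mul_le hp (norm_nonneg (∇ W x)) (inv_nonneg.2 hr1.le)
    rw [hrp] at y1 y2
    rw [hζx, Real.one_rpow]
    calc Real.exp (p * U x) * ((‖∇ U x‖ ^ (p - 1) + ‖∇ W x‖ ^ (p - 1)) * ‖∇ ψ x‖) * K x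
        ≤ (C * r ^ (-g)) ^ p * ((‖∇ U x‖ ^ (p - 1) + ‖∇ W x‖ ^ (p - 1)) * (M * r⁻¹)) * 1 := by
          have := hgψ x
          have := hK1 x
          have := hK0 x
          gcongr
      _ = B * (‖∇ U x‖ ^ (p - 1) * r⁻¹ + ‖∇ W x‖ ^ (p - 1) * r⁻¹) := by
          rw [hB]
          ring
      _ ≤ B * ((‖∇ U x‖ ^ p * 1 + ‖∇ W x‖ ^ p * 1) + 2 * r ^ (-p) * 1) := by
          refine mul_le_mul_of_nonneg_left ?_ hB0
          linarith
  have hnn : ∀ x, 0 ≤ Real.exp (p * U x) *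
      ((‖∇ U x‖ ^ (p - 1) + ‖∇ W x‖ ^ (p - 1)) * ‖∇ ψ x‖) * K x := fun x => by
    have := hK0 x
    positivity
  refine (integral_mono_of_nonneg (Eventually.of_forall hnn)
    (((iU.add iW).add (iζ.const_mul _)).const_mul B) (Eventually.of_forall hpt)).trans ?_
  have hsplit : ∫ x, B * ((‖∇ U x‖ ^ p * ζr x ^ p + ‖∇ W x‖ ^ p * ζr x ^ p) +
      2 * r ^ (-p) * ζr x ^ p) = B * (((∫ x, ‖∇ U x‖ ^ p * ζr x ^ p) +
      ∫ x, ‖∇ W x‖ ^ p * ζr x ^ p) + 2 * r ^ (-p) * ∫ x, ζr x ^ p) := by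
    have h1 := integral_add (iU.add iW) (iζ.const_mul (2 * r ^ (-p)))
    have h2 := integral_add iU iW
    simp only [Pi.add_apply] at h1
    rw [integral_const_mul, h1, h2, integral_const_mul]
  simp only [Pi.add_apply]
  rw [hsplit]
  rw [hgζ] at hcU hcW
  have hr' : r ^ (-p) * r ^ (d : ℝ) = r ^ ((d : ℝ) - p) := by
    rw [← Real.rpow_add hr1]
    congr 1
    ring
  calc _ ≤ B * ((CC * (r ^ ((d : ℝ) - p) * I₁) + CC * (r ^ ((d : ℝ) - p) * I₁)) +
        2 * r ^ (-p) * (r ^ (d : ℝ) * I₀)) := by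
        rw [hiζ]
        gcongr
    _ = C ^ p * M * (2 * CC * I₁ + 2 * I₀) * ((r ^ (-g)) ^ p * r ^ ((d : ℝ) - p)) := by
        rw [hB, Real.mul_rpow hC (by positivity), ← hr']
        ring
    _ = A * r ^ (-(g * p - (d - p))) := by
        rw [← Real.rpow_mul hr1.le, ← Real.rpow_add hr1, hA]
        congr 2
        ring
    _ ≤ ε := hrε.le

end Cutoff

/-! ### Comparison with reflections -/

section Reflection

variable {E : Type*} [NormedAddCommGroup E] [InnerProductSpace ℝ E]

/-- The reflection in the perpendicular bisector of two points with different norms, in the form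
`z ↦ L z + c`. Its fixed points are exactly the points whose norm it preserves. -/
theorem exists_bisector_reflection {x y : E} (hxy : ‖y‖ < ‖x‖) :
    ∃ (L : E ≃ₗᵢ[ℝ] E) (c : E), c ≠ 0 ∧ L c + c = 0 ∧ L x + c = y ∧
      ∀ z, ‖L z + c‖ = ‖z‖ → L z + c = z := by
  set d := x - y with hd
  have hd0 : d ≠ 0 := fun h => hxy.ne (by rw [sub_eq_zero.1 h])
  have hdn : 0 < ‖d‖ ^ 2 := by positivity
  set κ := ‖x‖ ^ 2 - ‖y‖ ^ 2 with hκ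
  have hκ0 : 0 < κ := by
    have := norm_nonneg y
    rw [hκ]
    nlinarith
  set L : E ≃ₗᵢ[ℝ] E := (Submodule.span ℝ {d})ᗮ.reflection with hL
  set c : E := (κ / ‖d‖ ^ 2) • d with hc
  have hs : ∀ z, L z + c = z + ((κ - 2 * inner ℝ d z) / ‖d‖ ^ 2) • d := by
    intro z
    rw [hL, Submodule.reflection_orthogonal_apply, Submodule.reflection_singleton_apply, hc]
    simp only [RCLike.ofReal_real_eq_id, id_eq]
    module
  have hdx : κ - 2 * inner ℝ d x = -‖d‖ ^ 2 := by
    rw [hd, inner_sub_left, norm_sub_sq_real, real_inner_self_eq_norm_sq, real_inner_comm x y]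
    ring
  have hdc : inner ℝ d c = κ := by
    rw [hc, real_inner_smul_right, real_inner_self_eq_norm_sq]
    field_simp
  refine ⟨L, c, smul_ne_zero (div_pos hκ0 hdn).ne' hd0, ?_, ?_, fun z hz => ?_⟩
  · rw [hs, hdc, hc, ← add_smul]
    convert zero_smul ℝ d
    ring
  · rw [hs, hdx, neg_div, div_self hdn.ne', hd]
    module
  · have h1 : ‖L z + c‖ ^ 2 = ‖z‖ ^ 2 + (κ - 2 * inner ℝ d z) / ‖d‖ ^ 2 * κ := by
      rw [hs, norm_add_sq_real, real_inner_smul_right, norm_smul, mul_pow, Real.norm_eq_abs, sq_abs,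
        real_inner_comm]
      field_simp
      ring
    rw [hz] at h1
    have h2 : (κ - 2 * inner ℝ d z) / ‖d‖ ^ 2 = 0 := by
      rcases mul_eq_zero.1 (by linarith : (κ - 2 * inner ℝ d z) / ‖d‖ ^ 2 * κ = 0) with h | h
      · exact h
      · exact absurd h hκ0.ne'
    rw [hs, h2, zero_smul, add_zero]

variable [FiniteDimensional ℝ E] [MeasurableSpace E] [BorelSpace E]

/-- A positive solution that blows up at the origin and decays at infinity does not increase when a
point is reflected towards the origin: on the half-space away from the origin the reflected
solution has the larger potential, and near the reflected origin it is infinite. -/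
theorem le_comp_reflection {p γ : ℝ} (hp : 1 < p) (hγ : 0 ≤ γ) {v : E → ℝ}
    (hv : ContDiffOn ℝ 1 v {0}ᶜ) (hpos : ∀ x, x ≠ 0 → 0 < v x)
    (hR : IsRiccatiSolution p (fun x => γ / ‖x‖ ^ p) (fun x => Real.log (v x)) {0}ᶜ)
    (hzero : Tendsto v (𝓝[≠] 0) atTop) {R C g : ℝ} (hC : 0 ≤ C) (hg : 0 ≤ g)
    (hdec : ∀ x, R < ‖x‖ → v x ≤ C * ‖x‖ ^ (-g))
    (hgp : Module.finrank ℝ E - p < g * p) (L : E ≃ₗᵢ[ℝ] E) {c : E} (hc : c ≠ 0)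
    (hLc : L c + c = 0) (hfix : ∀ z, ‖L z + c‖ = ‖z‖ → L z + c = z)
    {z : E} (hz : ‖L z + c‖ < ‖z‖) (hz0 : L z + c ≠ 0) : v z ≤ v (L z + c) := by
  classical
  set s : E → E := fun z => L z + c with hs
  have hsc : Continuous s := by fun_prop
  have hs1 : ContDiff ℝ 1 s := L.contDiff.add contDiff_const
  have hs0 : ∀ z, s z = 0 ↔ z = c := by
    intro z
    rw [← hLc]
    exact ⟨fun h => L.injective (add_right_cancel h), fun h => by rw [h]⟩
  set Ω : Set E := {0}ᶜ ∩ s ⁻¹' {0}ᶜ with hΩdef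
  have hΩ : IsOpen Ω := isOpen_compl_singleton.inter (isOpen_compl_singleton.preimage hsc)
  set U : E → ℝ := fun x => Real.log (v x) with hUdef
  set V : E → ℝ := fun x => γ / ‖x‖ ^ p with hVdef
  have hU' : ContDiffOn ℝ 1 U {0}ᶜ := hv.log fun x hx => (hpos x hx).ne'
  have hV' : ContinuousOn V {0}ᶜ := continuousOn_const.div
    (continuous_norm.continuousOn.rpow_const fun _ _ => Or.inr (by linarith)) fun x hx =>
      (Real.rpow_pos_of_pos (norm_pos_iff.2 hx) _).ne'
  have hV0 : ∀ x, 0 ≤ V x := fun x => by positivity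
  have hU : ContDiffOn ℝ 1 U Ω := hU'.mono inter_subset_left
  have hW : ContDiffOn ℝ 1 (fun x => U (s x)) Ω :=
    hU'.comp hs1.contDiffOn fun x hx => hx.2
  have h₁ : IsRiccatiSolution p V U Ω := hR.mono inter_subset_left
  have h₂ : IsRiccatiSolution p (fun x => V (s x)) (fun x => U (s x)) Ω :=
    (hR.comp_isometry L c).mono inter_subset_right
  have hV₁ : ContinuousOn V Ω := hV'.mono inter_subset_left
  have hV₂ : ContinuousOn (fun x => V (s x)) Ω :=
    hV'.comp hsc.continuousOn fun x hx => hx.2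
  suffices H : ∀ δ > 0, U z - U (s z) ≤ δ by
    have h0 : U z - U (s z) ≤ 0 := le_of_forall_pos_le_add fun δ hδ => by simpa using H δ hδ
    have hz' : z ≠ 0 := fun h => by
      rw [h, norm_zero] at hz
      exact absurd hz (not_lt.2 (norm_nonneg _))
    exact (Real.log_le_log_iff (hpos z hz') (hpos _ hz0)).1 (sub_nonpos.1 h0)
  intro δ hδ
  set G : E → ℝ := fun x => Real.smoothTransition (U x - U (s x) - δ) with hGdef
  set K : E → ℝ := fun x => if ‖s x‖ < ‖x‖ ∧ s x ≠ 0 then G x else 0 with hKdef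
  have hloc : ∀ x, K =ᶠ[𝓝 x] (fun _ => 0) ∨ (x ∈ Ω ∧ K =ᶠ[𝓝 x] G) := by
    intro x
    by_cases hx0 : s x = 0
    · -- the reflected origin, where `U ∘ s = ∞`
      left
      have hx : x ≠ 0 := by
        rw [(hs0 x).1 hx0]
        exact hc
      have e1 : ∀ᶠ y in 𝓝 x, s y ≠ 0 → v x + 1 < v (s y) := by
        have h1 := hzero.eventually (eventually_gt_atTop (v x + 1))
        rw [eventually_nhdsWithin_iff] at h1
        have h2 : Tendsto s (𝓝 x) (𝓝 0) := by
          rw [← hx0]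
          exact hsc.tendsto x
        exact h2.eventually h1
      have e2 : ∀ᶠ y in 𝓝 x, v y < v x + 1 :=
        (hv.continuousOn.continuousAt (isOpen_compl_singleton.mem_nhds hx)).eventually
          (gt_mem_nhds (by linarith))
      have e3 : ∀ᶠ y in 𝓝 x, y ≠ 0 := isOpen_compl_singleton.mem_nhds hx
      filter_upwards [e1, e2, e3] with y h1 h2 h3
      by_cases hy : ‖s y‖ < ‖y‖ ∧ s y ≠ 0
      · rw [hKdef]
        simp only [hy, if_true, hGdef, ne_eq, not_false_eq_true, and_self]
        refine Real.smoothTransition.zero_of_nonpos ?_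
        have : U y ≤ U (s y) := Real.log_le_log (hpos y h3) (h2.trans (h1 hy.2)).le
        linarith
      · simp [hKdef, hy]
    · rcases lt_trichotomy ‖s x‖ ‖x‖ with h | h | h
      · right
        have hx : x ≠ 0 := norm_pos_iff.1 ((norm_nonneg _).trans_lt h)
        refine ⟨⟨hx, hx0⟩, ?_⟩
        have e1 : ∀ᶠ y in 𝓝 x, ‖s y‖ < ‖y‖ :=
          (isOpen_lt hsc.norm continuous_norm).mem_nhds h
        have e2 : ∀ᶠ y in 𝓝 x, s y ≠ 0 :=
          (isOpen_compl_singleton.preimage hsc).mem_nhds hx0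
        filter_upwards [e1, e2] with y h1 h2
        simp [hKdef, h1, h2]
      · -- the mirror, where `U - U ∘ s = 0`
        left
        have hsx : s x = x := hfix x h
        have hx : x ≠ 0 := hsx ▸ hx0
        have hxΩ : x ∈ Ω := ⟨hx, hx0⟩
        have hcont : ContinuousAt (fun y => U y - U (s y)) x :=
          (hU.continuousOn.sub hW.continuousOn).continuousAt (hΩ.mem_nhds hxΩ)
        have e1 : ∀ᶠ y in 𝓝 x, U y - U (s y) < δ :=
          hcont.eventually (gt_mem_nhds (by simpa [hsx] using hδ))
        filter_upwards [e1] with y h1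
        have : G y = 0 := Real.smoothTransition.zero_of_nonpos (by linarith)
        simp [hKdef, this]
      · left
        have e1 : ∀ᶠ y in 𝓝 x, ‖y‖ < ‖s y‖ :=
          (isOpen_lt continuous_norm hsc.norm).mem_nhds h
        filter_upwards [e1] with y h1
        simp [hKdef, h1.le.not_gt]
  have hG : ContDiffOn ℝ 1 G Ω :=
    (Real.smoothTransition.contDiff (n := 1)).comp_contDiffOn ((hU.sub hW).sub contDiffOn_const)
  have hK : ContDiff ℝ 1 K := by
    rw [contDiff_iff_contDiffAt]
    intro x
    rcases hloc x with h | ⟨hx, h⟩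
    · exact contDiffAt_const.congr_of_eventuallyEq h
    · exact (hG.contDiffAt (hΩ.mem_nhds hx)).congr_of_eventuallyEq h
  have hKΩ : tsupport K ⊆ Ω := by
    intro x hx
    rcases hloc x with h | ⟨hx', -⟩
    · exact absurd hx (notMem_tsupport_iff_eventuallyEq.2 h)
    · exact hx'
  have hK0 : ∀ x, 0 ≤ K x := fun x => by
    simp only [hKdef]
    split_ifs
    · exact Real.smoothTransition.nonneg _
    · exact le_rfl
  have hK1 : ∀ x, K x ≤ 1 := fun x => by
    simp only [hKdef]
    split_ifs
    · exact Real.smoothTransition.le_one _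
    · exact zero_le_one
  have hKV : ∀ x, K x ≠ 0 → V x ≤ V (s x) := by
    intro x hx
    have hcond : ‖s x‖ < ‖x‖ ∧ s x ≠ 0 := by
      by_contra h
      exact hx (by simp [hKdef, h])
    have h1 := Real.rpow_le_rpow (norm_nonneg _) hcond.1.le (by linarith : 0 ≤ p)
    have h2 : 0 < ‖s x‖ ^ p := Real.rpow_pos_of_pos (norm_pos_iff.2 hcond.2) _
    exact div_le_div_of_nonneg_left hγ h2 h1
  have hgrad : ∀ x, ∃ k : ℝ, 0 ≤ k ∧ ∇ K x = k • (∇ U x - ∇ (fun y => U (s y)) x) := by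
    intro x
    rcases hloc x with h | ⟨hx, h⟩
    · refine ⟨0, le_rfl, ?_⟩
      rw [h.gradient_eq, zero_smul]
      exact gradient_fun_const x 0
    · refine ⟨deriv Real.smoothTransition (U x - U (s x) - δ),
        Real.smoothTransition.monotone.deriv_nonneg, ?_⟩
      rw [h.gradient_eq]
      have hd : HasDerivAt (fun t => Real.smoothTransition (t - δ))
          (deriv Real.smoothTransition (U x - U (s x) - δ)) (U x - U (s x)) := by
        have h1 := ((Real.smoothTransition.contDiff (n := 1)).differentiable one_ne_zero
          (U x - U (s x) - δ)).hasDerivAt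
        exact h1.comp_sub_const _ _
      have hD := hasGradientAt_sub (hasGradientAt_of_contDiffOn hΩ hU hx)
        (hasGradientAt_of_contDiffOn hΩ hW hx)
      exact (hasGradientAt_comp (f := fun y => U y - U (s y)) hd hD).gradient
  have hcut := exists_cutoff hp hΩ hV₁ hV₂ (fun x _ => hV0 x) (fun x _ => hV0 _) hU hW h₁ h₂
    hK0 hK1 (R := max R (max 0 ‖c‖)) hC hg
    (fun x hx => by
      have h1 : max 0 ‖c‖ < ‖x‖ := (le_max_right _ _).trans_lt hx
      refine ⟨norm_pos_iff.1 ((le_max_left _ _).trans_lt h1), fun h => ?_⟩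
      rw [(hs0 x).1 h] at h1
      exact absurd h1 (not_lt.2 (le_max_right _ _)))
    (fun x hx => by
      have h1 : max 0 ‖c‖ < ‖x‖ := (le_max_right _ _).trans_lt hx
      rw [Real.exp_log (hpos x (norm_pos_iff.1 ((le_max_left _ _).trans_lt h1)))]
      exact hdec x ((le_max_left _ _).trans_lt hx)) hgp
  have hzeroK := gradient_eq_zero_of_comparison hp hΩ hV₁ hV₂ hU hW h₁ h₂ hK hKΩ hK0 hKV hgrad
    (fun ρ ε hε => hcut ρ hε)
  have hconst : K z = K 0 := by
    refine is_const_of_fderiv_eq_zero (𝕜 := ℝ) (hK.differentiable one_ne_zero) (fun x => ?_) z 0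
    rw [← norm_eq_zero, ← norm_gradient, hzeroK, norm_zero]
  have hKz : K z = G z := by simp only [hKdef]; exact if_pos ⟨hz, hz0⟩
  have hK00 : K 0 = 0 := by
    simp [hKdef]
  rw [hKz, hK00] at hconst
  have := Real.smoothTransition.zero_iff_nonpos.1 hconst
  linarith

/-- Such a solution is nonincreasing in the norm. -/
theorem le_of_norm_lt {p γ : ℝ} (hp : 1 < p) (hγ : 0 ≤ γ) {v : E → ℝ}
    (hv : ContDiffOn ℝ 1 v {0}ᶜ) (hpos : ∀ x, x ≠ 0 → 0 < v x)
    (hR : IsRiccatiSolution p (fun x => γ / ‖x‖ ^ p) (fun x => Real.log (v x)) {0}ᶜ)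
    (hzero : Tendsto v (𝓝[≠] 0) atTop) {R C g : ℝ} (hC : 0 ≤ C) (hg : 0 ≤ g)
    (hdec : ∀ x, R < ‖x‖ → v x ≤ C * ‖x‖ ^ (-g))
    (hgp : Module.finrank ℝ E - p < g * p) {x y : E} (hy : y ≠ 0) (hxy : ‖y‖ < ‖x‖) :
    v x ≤ v y := by
  obtain ⟨L, c, hc, hLc, hLx, hfix⟩ := exists_bisector_reflection hxy
  have := le_comp_reflection hp hγ hv hpos hR hzero hC hg hdec hgp L hc hLc hfix
    (z := x) (by rwa [hLx]) (by rwa [hLx])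
  rwa [hLx] at this

end Reflection

/-! ### The radial profile -/

section Radial

/-- The larger root exceeds the critical exponent `(N - p) / p`, at which the defining function is
negative. -/
theorem lt_of_isGreatest_exponentRoots {N : ℕ} {p γ γ₂ : ℝ} (hp : 1 < p) (hpN : p < N)
    (hγ : 0 ≤ γ) (hγp : γ < ((N - p) / p) ^ p) (hγ₂ : IsGreatest (exponentRoots N p γ) γ₂) :
    (N - p) / p < γ₂ := by
  have hp1 : 0 < p - 1 := by linarith
  have hq : 0 < (N : ℝ) - p := by linarith
  set a : ℝ := (N - p) / p with ha
  set b : ℝ := (N - p) / (p - 1) with hb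
  have ha0 : 0 < a := by positivity
  have hab : a ≤ b := div_le_div_of_nonneg_left hq.le hp1 (by linarith)
  set h : ℝ → ℝ := fun μ => μ ^ (p - 2) * ((p - 1) * μ ^ 2 - (N - p) * μ) + γ with hh
  have hha : h a < 0 := by
    have e1 : (N : ℝ) - p = p * a := by
      rw [ha]
      field_simp
    have e2 : a ^ (p - 2) * a ^ 2 = a ^ p := by
      rw [← Real.rpow_natCast, ← Real.rpow_add ha0]
      congr 1
      push_cast
      ring
    have : h a = γ - a ^ p := by
      rw [hh, ← e2]
      simp only [e1]
      ring
    linarith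
  have hhb : 0 ≤ h b := by
    have : (p - 1) * b ^ 2 - (N - p) * b = 0 := by
      rw [hb]
      field_simp
      ring
    simp only [hh, this, mul_zero, zero_add]
    exact hγ
  have hcont : ContinuousOn h (Icc a b) := by
    refine ContinuousOn.add (ContinuousOn.mul ?_ (by fun_prop)) continuousOn_const
    exact continuousOn_id.rpow_const fun x hx => Or.inl (ha0.trans_le hx.1).ne'
  obtain ⟨μ, hμ, hμ0⟩ := intermediate_value_Icc hab hcont ⟨hha.le, hhb⟩
  have hne : a ≠ μ := fun h0 => by
    rw [← h0] at hμ0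
    exact hha.ne hμ0
  exact (lt_of_le_of_ne hμ.1 hne).trans_le (hγ₂.2 ⟨ha0.le.trans hμ.1, hμ0⟩)

/-- A function that decreases somewhere violates `∫ H θ' ≤ 0` for some nonnegative test function
`θ`, which rises near `r₁` and falls near `r₀`. -/
theorem exists_integral_mul_deriv_pos {H : ℝ → ℝ} (hH : ContinuousOn H (Ioi 0)) {r₁ r₀ : ℝ}
    (hr₁ : 0 < r₁) (hr : r₁ < r₀) (hlt : H r₀ < H r₁) :
    ∃ (θ : ℝ → ℝ) (b : ℝ), ContDiff ℝ ∞ θ ∧ (∀ r, 0 ≤ θ r) ∧ tsupport θ ⊆ Icc r₁ b ∧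
      0 < ∫ r in Ioi 0, H r * deriv θ r := by
  obtain ⟨m₀, hm₀, hm₀'⟩ := exists_between hlt
  obtain ⟨m₁, hm₁, hm₁'⟩ := exists_between hm₀'
  obtain ⟨w₁, hw₁, hW₁⟩ := Metric.eventually_nhds_iff.1
    ((hH.continuousAt (Ioi_mem_nhds hr₁)).eventually (lt_mem_nhds hm₁'))
  obtain ⟨w₀, hw₀, hW₀⟩ := Metric.eventually_nhds_iff.1
    ((hH.continuousAt (Ioi_mem_nhds (hr₁.trans hr))).eventually (gt_mem_nhds hm₀))
  set w := min w₁ w₀ / 2 with hw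
  have hmin : 0 < min w₁ w₀ := lt_min hw₁ hw₀
  have hwpos : 0 < w := half_pos hmin
  have hww₁ : w < w₁ := (half_lt_self hmin).trans_le (min_le_left _ _)
  have hww₀ : w < w₀ := (half_lt_self hmin).trans_le (min_le_right _ _)
  let T : ℝ → ℝ → ℝ := fun c r => Real.smoothTransition ((r - c) / w)
  have hT : ∀ c, ContDiff ℝ ∞ (T c) := fun c =>
    Real.smoothTransition.contDiff.comp ((contDiff_id.sub contDiff_const).div_const w)
  have hTd : ∀ c r, HasDerivAt (T c) (deriv (T c) r) r := fun c r =>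
    ((hT c).differentiable (by simp) r).hasDerivAt
  have hTm : ∀ c, Monotone (T c) := fun c r s hrs =>
    Real.smoothTransition.monotone (by gcongr)
  have hT0 : ∀ c r, r ≤ c → T c r = 0 := fun c r hrc =>
    Real.smoothTransition.zero_of_nonpos (div_nonpos_of_nonpos_of_nonneg (by linarith) hwpos.le)
  have hT1 : ∀ c r, c + w ≤ r → T c r = 1 := fun c r hrc =>
    Real.smoothTransition.one_of_one_le ((one_le_div hwpos).2 (by linarith))
  have hd0 : ∀ c r, 0 ≤ deriv (T c) r := fun c r => (hTm c).deriv_nonneg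
  have hdz : ∀ c r, r ∉ Icc c (c + w) → deriv (T c) r = 0 := by
    intro c r hrc
    rw [mem_Icc, not_and_or, not_le, not_le] at hrc
    rcases hrc with h | h
    · have : T c =ᶠ[𝓝 r] fun _ => 0 := by
        filter_upwards [gt_mem_nhds h] with s hs using hT0 c s hs.le
      rw [this.deriv_eq, deriv_const]
    · have : T c =ᶠ[𝓝 r] fun _ => 1 := by
        filter_upwards [lt_mem_nhds h] with s hs using hT1 c s hs.le
      rw [this.deriv_eq, deriv_const]
  set θ : ℝ → ℝ := fun r => T r₁ r - T r₀ r with hθ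
  have hθ1 : ContDiff ℝ ∞ θ := (hT r₁).sub (hT r₀)
  have hθd : ∀ r, deriv θ r = deriv (T r₁) r - deriv (T r₀) r := fun r =>
    ((hTd r₁ r).sub (hTd r₀ r)).deriv
  have hθs : tsupport θ ⊆ Icc r₁ (r₀ + w) := by
    refine closure_minimal (fun r hr' => ?_) isClosed_Icc
    by_contra hc
    refine hr' ?_
    rw [mem_Icc, not_and_or, not_le, not_le] at hc
    rcases hc with h | h
    · simp only [hθ, hT0 r₁ r h.le, hT0 r₀ r (h.le.trans hr.le), sub_self]
    · simp only [hθ, hT1 r₁ r (by linarith), hT1 r₀ r h.le, sub_self]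
  have hθc : HasCompactSupport θ :=
    HasCompactSupport.of_support_subset_isCompact isCompact_Icc ((subset_tsupport θ).trans hθs)
  refine ⟨θ, r₀ + w, hθ1, fun r => ?_, hθs, ?_⟩
  · refine sub_nonneg.2 (Real.smoothTransition.monotone ?_)
    gcongr
  have hTcont : ∀ c, Continuous (deriv (T c)) := fun c =>
    (hT c).continuous_deriv (by simp)
  have hTc : ∀ c, HasCompactSupport (deriv (T c)) := fun c =>
    HasCompactSupport.of_support_subset_isCompact (isCompact_Icc (a := c) (b := c + w))
      fun r hr' => by
        by_contra hc
        exact hr' (hdz c r hc)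
  have iT : ∀ c, Integrable (deriv (T c)) := fun c =>
    (hTcont c).integrable_of_hasCompactSupport (hTc c)
  have iθ : Integrable (deriv θ) := by
    rw [show deriv θ = _ from funext hθd]
    exact (iT r₁).sub (iT r₀)
  have hθ' : ∫ r in Ioi 0, deriv θ r = 0 := by
    rw [hθc.integral_Ioi_deriv_eq (hθ1.of_le (by simp)) 0]
    simp [hθ, hT0 r₁ 0 hr₁.le, hT0 r₀ 0 (hr₁.trans hr).le]
  have hT' : ∫ r in Ioi 0, deriv (T r₁) r = 1 := by
    have hlim : Tendsto (T r₁) atTop (𝓝 1) :=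
      tendsto_const_nhds.congr' (by
        filter_upwards [eventually_ge_atTop (r₁ + w)] with r hr' using (hT1 r₁ r hr').symm)
    rw [integral_Ioi_of_hasDerivAt_of_tendsto' (fun r _ => hTd r₁ r) (iT r₁).integrableOn hlim,
      hT0 r₁ 0 hr₁.le, sub_zero]
  have hpt : ∀ r, m₀ * deriv θ r + (m₁ - m₀) * deriv (T r₁) r ≤ H r * deriv θ r := by
    intro r
    have h1 : m₁ * deriv (T r₁) r ≤ H r * deriv (T r₁) r := by
      by_cases hr' : r ∈ Icc r₁ (r₁ + w)
      · refine mul_le_mul_of_nonneg_right (hW₁ ?_).le (hd0 _ _)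
        rw [Real.dist_eq, abs_of_nonneg (by linarith [hr'.1])]
        linarith [hr'.2]
      · rw [hdz _ _ hr', mul_zero, mul_zero]
    have h0 : H r * deriv (T r₀) r ≤ m₀ * deriv (T r₀) r := by
      by_cases hr' : r ∈ Icc r₀ (r₀ + w)
      · refine mul_le_mul_of_nonneg_right (hW₀ ?_).le (hd0 _ _)
        rw [Real.dist_eq, abs_of_nonneg (by linarith [hr'.1])]
        linarith [hr'.2]
      · rw [hdz _ _ hr', mul_zero, mul_zero]
    rw [hθd]
    linarith
  have iH : Integrable fun r => H r * deriv θ r := by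
    refine (continuous_mul_of_tsupport_subset isOpen_Ioi hH ?_ ?_).integrable_of_hasCompactSupport
      (hθc.deriv.mul_left)
    · exact hθ1.continuous_deriv (by simp)
    · exact (tsupport_deriv_subset (𝕜 := ℝ)).trans (hθs.trans fun r hr' => hr₁.trans_le hr'.1)
  have hint := integral_mono ((iθ.integrableOn (s := Ioi 0)).const_mul m₀ |>.add
    ((iT r₁).integrableOn (s := Ioi 0) |>.const_mul (m₁ - m₀))) (iH.integrableOn (s := Ioi 0)) hpt
  have e := integral_add ((iθ.integrableOn (s := Ioi 0)).const_mul m₀)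
    ((iT r₁).integrableOn (s := Ioi 0) |>.const_mul (m₁ - m₀))
  simp only [Pi.add_apply] at hint
  rw [e, integral_const_mul, integral_const_mul, hθ', hT'] at hint
  linarith

variable {E : Type*} [NormedAddCommGroup E] [InnerProductSpace ℝ E]

/-- A continuous function on the punctured space that does not increase with the norm is radial. -/
theorem eq_of_norm_eq_of_le {v : E → ℝ} (hv : ContinuousOn v {0}ᶜ)
    (hle : ∀ x y : E, y ≠ 0 → ‖y‖ < ‖x‖ → v x ≤ v y) {x y : E} (hy : y ≠ 0)
    (hxy : ‖x‖ = ‖y‖) : v x = v y := by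
  have key : ∀ x y : E, y ≠ 0 → ‖x‖ = ‖y‖ → v x ≤ v y := by
    intro x y hy hxy
    have hc : ContinuousAt (fun t : ℝ => v (t • y)) 1 := by
      refine ContinuousAt.comp (f := fun t : ℝ => t • y) (g := v) ?_ (by fun_prop)
      rw [one_smul]
      exact hv.continuousAt (isOpen_compl_singleton.mem_nhds hy)
    have ht : Tendsto (fun t : ℝ => v (t • y)) (𝓝[<] 1) (𝓝 (v y)) := by
      have := hc.tendsto
      rw [one_smul] at this
      exact this.mono_left nhdsWithin_le_nhds
    refine ge_of_tendsto ht ?_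
    filter_upwards [Ioo_mem_nhdsLT (zero_lt_one (α := ℝ))] with t ht
    refine hle x (t • y) (smul_ne_zero ht.1.ne' hy) ?_
    rw [norm_smul, Real.norm_of_nonneg ht.1.le, hxy]
    have := norm_pos_iff.2 hy
    nlinarith [ht.2]
  refine le_antisymm (key x y hy hxy) (key y x ?_ hxy.symm)
  rw [← norm_pos_iff, hxy]
  exact norm_pos_iff.2 hy

variable [FiniteDimensional ℝ E]

theorem hasGradientAt_norm {x : E} (hx : x ≠ 0) :
    HasGradientAt (fun y : E => ‖y‖) (‖x‖⁻¹ • x) x := by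
  have hn : 0 < ‖x‖ := norm_pos_iff.2 hx
  have h1 : HasGradientAt (fun y : E => ‖y‖ ^ 2) ((2 : ℝ) • x) x := by
    rw [hasGradientAt_iff_hasFDerivAt]
    refine (hasStrictFDerivAt_norm_sq x).hasFDerivAt.congr_fderiv ?_
    ext y
    simp
  have h2 := hasGradientAt_comp (f := fun y : E => ‖y‖ ^ 2)
    (Real.hasDerivAt_sqrt (by positivity : ‖x‖ ^ 2 ≠ 0)) h1
  have h3 : (fun y : E => Real.sqrt (‖y‖ ^ 2)) = fun y => ‖y‖ :=
    funext fun y => Real.sqrt_sq (norm_nonneg y)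
  rw [h3, Real.sqrt_sq hn.le, smul_smul] at h2
  convert h2 using 2
  field_simp

theorem contDiff_comp_norm {θ : ℝ → ℝ} (hθ : ContDiff ℝ ∞ θ) {a b : ℝ} (ha : 0 < a)
    (hs : tsupport θ ⊆ Icc a b) : ContDiff ℝ ∞ (fun x : E => θ ‖x‖) ∧
      HasCompactSupport (fun x : E => θ ‖x‖) ∧
      tsupport (fun x : E => θ ‖x‖) ⊆ {x | ‖x‖ ∈ Icc a b} := by
  have hsup : tsupport (fun x : E => θ ‖x‖) ⊆ {x | ‖x‖ ∈ Icc a b} :=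
    closure_minimal (fun x hx => hs (subset_tsupport θ hx)) (isClosed_Icc.preimage continuous_norm)
  refine ⟨?_, ?_, hsup⟩
  · rw [contDiff_iff_contDiffAt]
    intro x
    by_cases hx : x = 0
    · have : x ∉ tsupport (fun x : E => θ ‖x‖) := fun h => by
        have := (hsup h).1
        rw [hx, norm_zero] at this
        linarith
      exact contDiffAt_const.congr_of_eventuallyEq (notMem_tsupport_iff_eventuallyEq.1 this)
    · exact hθ.contDiffAt.comp x (contDiffAt_norm ℝ hx)
  · refine HasCompactSupport.of_support_subset_isCompact (isCompact_closedBall (0 : E) b)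
      fun x hx => ?_
    rw [mem_closedBall_zero_iff]
    exact (hsup (subset_tsupport _ hx)).2

variable [MeasurableSpace E] [BorelSpace E]

/-- The radial equation says that `r^{N-1} |f'(r)|^{p-1}` does not decrease, since
`-Δ_p v = F ≥ 0`. -/
theorem flux_monotone_of_radial [Nontrivial E] {p : ℝ} (hp : 1 < p) {v F : E → ℝ} {f : ℝ → ℝ}
    (hF : ∀ x, x ≠ 0 → 0 ≤ F x)
    (hw : ∀ φ : E → ℝ, ContDiff ℝ ∞ φ → HasCompactSupport φ → tsupport φ ⊆ {0}ᶜ →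
      ∫ x, inner ℝ (flux p (∇ v x)) (∇ φ x) = ∫ x, F x * φ x)
    (hf : ContDiffOn ℝ 1 f (Ioi 0)) (hf' : ∀ r, 0 < r → deriv f r ≤ 0)
    (hvf : ∀ x, x ≠ 0 → v x = f ‖x‖) {r₁ r₀ : ℝ} (hr₁ : 0 < r₁) (hr : r₁ < r₀) :
    r₁ ^ (Module.finrank ℝ E - 1) * |deriv f r₁| ^ (p - 1) ≤
      r₀ ^ (Module.finrank ℝ E - 1) * |deriv f r₀| ^ (p - 1) := by
  by_contra! hlt
  set d := Module.finrank ℝ E with hd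
  set P : ℝ → ℝ := fun r => |deriv f r| ^ (p - 1) with hP
  have hH : ContinuousOn (fun r => r ^ (d - 1) * P r) (Ioi 0) :=
    (continuous_pow _).continuousOn.mul
      ((hf.continuousOn_deriv_of_isOpen isOpen_Ioi le_rfl).abs.rpow_const
        fun _ _ => Or.inr (by linarith))
  obtain ⟨θ, b, hθ, hθ0, hθs, hpos⟩ := exists_integral_mul_deriv_pos hH hr₁ hr hlt
  obtain ⟨hφ, hφc, hφs⟩ := contDiff_comp_norm (E := E) hθ hr₁ hθs
  have hφ0 : tsupport (fun x : E => θ ‖x‖) ⊆ {0}ᶜ := fun x hx h0 => by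
    have h1 := (hφs hx).1
    rw [mem_singleton_iff.1 h0, norm_zero] at h1
    linarith
  have hmain := hw _ hφ hφc hφ0
  have hpt : ∀ x : E, inner ℝ (flux p (∇ v x)) (∇ (fun x : E => θ ‖x‖) x) =
      -(P ‖x‖ * deriv θ ‖x‖) := by
    intro x
    by_cases hx : x = 0
    · have h1 : x ∉ tsupport (fun x : E => θ ‖x‖) := fun h => hφ0 h hx
      have h2 : ‖x‖ ∉ tsupport θ := fun h => by
        have := (hθs h).1
        rw [hx, norm_zero] at this
        linarith
      rw [gradient_eq_zero_of_notMem_tsupport h1, inner_zero_right,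
        (notMem_tsupport_iff_eventuallyEq.1 h2).deriv_eq]
      simp
    · have hn : 0 < ‖x‖ := norm_pos_iff.2 hx
      have hu : ‖(‖x‖⁻¹ • x : E)‖ = 1 := by
        rw [norm_smul, norm_inv, norm_norm, inv_mul_cancel₀ hn.ne']
      have hgθ : ∇ (fun x : E => θ ‖x‖) x = deriv θ ‖x‖ • (‖x‖⁻¹ • x) :=
        (hasGradientAt_comp ((hθ.differentiable (by simp) ‖x‖).hasDerivAt)
          (hasGradientAt_norm hx)).gradient
      have hgv : ∇ v x = -(|deriv f ‖x‖|) • (‖x‖⁻¹ • x) := by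
        have h1 : v =ᶠ[𝓝 x] fun y => f ‖y‖ := by
          filter_upwards [isOpen_compl_singleton.mem_nhds hx] with y hy using hvf y hy
        have h2 : HasDerivAt f (deriv f ‖x‖) ‖x‖ :=
          ((hf.contDiffAt (Ioi_mem_nhds hn)).differentiableAt one_ne_zero).hasDerivAt
        rw [h1.gradient_eq, (hasGradientAt_comp h2 (hasGradientAt_norm hx)).gradient,
          abs_of_nonpos (hf' _ hn), neg_neg]
      set u : E := ‖x‖⁻¹ • x with hudef
      set t := |deriv f ‖x‖| with ht
      have ht0 : 0 ≤ t := abs_nonneg _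
      have e : t ^ (p - 2) * t = t ^ (p - 1) := by
        rw [← Real.rpow_add_one' ht0 (by linarith)]
        congr 1
        ring
      rw [hgv, hgθ, flux, norm_smul, hu, Real.norm_eq_abs, abs_neg, abs_of_nonneg ht0, mul_one]
      simp only [real_inner_smul_left, real_inner_smul_right, real_inner_self_eq_norm_sq, hu]
      simp only [hP, ← ht, ← e]
      ring
  simp_rw [hpt] at hmain
  rw [integral_fun_norm_addHaar (volume : Measure E) fun r => -(P r * deriv θ r)] at hmain
  have hRHS : 0 ≤ ∫ x, F x * θ ‖x‖ := by
    refine integral_nonneg fun x => ?_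
    by_cases hx : x ∈ tsupport (fun x : E => θ ‖x‖)
    · exact mul_nonneg (hF x (hφ0 hx)) (hθ0 _)
    · exact (mul_eq_zero_of_right _ (image_eq_zero_of_notMem_tsupport hx)).ge
  have hI : ∫ r in Ioi (0 : ℝ), r ^ (d - 1) • -(P r * deriv θ r) =
      -∫ r in Ioi (0 : ℝ), r ^ (d - 1) * P r * deriv θ r := by
    rw [← integral_neg]
    congr 1
    ext r
    rw [smul_eq_mul]
    ring
  rw [← hmain, ← hd, hI] at hRHS
  have hd0 : 0 < d := Module.finrank_pos
  have hvol : 0 < (volume : Measure E).real (Metric.ball 0 1) :=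
    ENNReal.toReal_pos (Metric.measure_ball_pos _ _ one_pos).ne' measure_ball_lt_top.ne
  rw [nsmul_eq_mul, smul_eq_mul] at hRHS
  have : 0 < (d : ℝ) * ((volume : Measure E).real (Metric.ball 0 1) *
      ∫ r in Ioi (0 : ℝ), r ^ (d - 1) * P r * deriv θ r) := by positivity
  linarith

/-- The radial profile has negative derivative: a critical radius would make the flux, hence the
derivative, vanish at all smaller radii, and `f` would be bounded near `0`. -/
theorem exists_radial_profile [Nontrivial E] {p : ℝ} (hp : 1 < p) {v F : E → ℝ}
    (hF : ∀ x, x ≠ 0 → 0 ≤ F x)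
    (hw : ∀ φ : E → ℝ, ContDiff ℝ ∞ φ → HasCompactSupport φ → tsupport φ ⊆ {0}ᶜ →
      ∫ x, inner ℝ (flux p (∇ v x)) (∇ φ x) = ∫ x, F x * φ x)
    (hv : ContDiffOn ℝ 1 v {0}ᶜ) (hzero : Tendsto v (𝓝[≠] 0) atTop)
    (hle : ∀ x y : E, y ≠ 0 → ‖y‖ < ‖x‖ → v x ≤ v y) :
    ∃ f : ℝ → ℝ, (∀ x, x ≠ 0 → v x = f ‖x‖) ∧
      StrictAntiOn f (Ioi 0) ∧ ∀ r, 0 < r → deriv f r < 0 := by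
  obtain ⟨e, he⟩ := exists_norm_eq E (zero_le_one (α := ℝ))
  have he0 : e ≠ 0 := by
    rw [← norm_pos_iff, he]
    exact one_pos
  set f : ℝ → ℝ := fun r => v (r • e) with hf
  have hre : ∀ r : ℝ, 0 < r → r • e ≠ 0 := fun r hr => smul_ne_zero hr.ne' he0
  have hrn : ∀ r : ℝ, 0 < r → ‖r • e‖ = r := fun r hr => by
    rw [norm_smul, he, mul_one, Real.norm_of_nonneg hr.le]
  have hvf : ∀ x, x ≠ 0 → v x = f ‖x‖ := fun x hx =>
    have hn := norm_pos_iff.2 hx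
    eq_of_norm_eq_of_le hv.continuousOn hle (hre _ hn) (hrn _ hn).symm
  have hf1 : ContDiffOn ℝ 1 f (Ioi 0) :=
    hv.comp (contDiff_id.smul contDiff_const).contDiffOn fun r hr => hre r hr
  have hanti : AntitoneOn f (Ioi 0) := by
    intro r hr s hs hrs
    rcases hrs.eq_or_lt with rfl | h
    · exact le_rfl
    · exact hle _ _ (hre r hr) (by rwa [hrn r hr, hrn s hs])
  have hf' : ∀ r, 0 < r → deriv f r ≤ 0 := by
    intro r hr
    have h1 : derivWithin f (Ioi 0) r ≤ 0 := hanti.derivWithin_nonpos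
    rwa [derivWithin_of_isOpen isOpen_Ioi hr] at h1
  have hneg : ∀ r, 0 < r → deriv f r < 0 := by
    intro r₀ hr₀
    refine lt_of_le_of_ne (hf' r₀ hr₀) fun h0 => ?_
    have hz : ∀ r ∈ Ioo 0 r₀, deriv f r = 0 := by
      intro r hr
      have := flux_monotone_of_radial hp hF hw hf1 hf' hvf hr.1 hr.2
      rw [h0, abs_zero, Real.zero_rpow (by linarith), mul_zero] at this
      by_contra hne
      have h1 : 0 < r ^ (Module.finrank ℝ E - 1) := pow_pos hr.1 _
      have h2 : 0 < |deriv f r| ^ (p - 1) := Real.rpow_pos_of_pos (abs_pos.2 hne) _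
      exact absurd this (not_le.2 (mul_pos h1 h2))
    have hdiff : DifferentiableOn ℝ f (Ioo 0 r₀) :=
      (hf1.differentiableOn one_ne_zero).mono fun r hr => hr.1
    have hconst : ∀ r ∈ Ioo 0 r₀, f r = f (r₀ / 2) := fun r hr =>
      isOpen_Ioo.is_const_of_deriv_eq_zero isPreconnected_Ioo hdiff hz hr
        ⟨half_pos hr₀, half_lt_self hr₀⟩
    have hlim : Tendsto f (𝓝[>] 0) atTop := by
      refine hzero.comp (tendsto_nhdsWithin_iff.2 ⟨?_, ?_⟩)
      · have : Continuous fun r : ℝ => r • e := by fun_prop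
        have h := this.tendsto 0
        rw [zero_smul] at h
        exact h.mono_left nhdsWithin_le_nhds
      · filter_upwards [self_mem_nhdsWithin] with r hr using hre r hr
    obtain ⟨r, hr, hr'⟩ := ((hlim.eventually (eventually_gt_atTop (f (r₀ / 2)))).and
      (Ioo_mem_nhdsGT hr₀)).exists
    exact hr.ne' (hconst r hr')
  refine ⟨f, hvf, ?_, hneg⟩
  refine strictAntiOn_of_deriv_neg (convex_Ioi 0) hf1.continuousOn fun r hr => ?_
  rw [interior_Ioi] at hr
  exact hneg r hr

end Radial

end HardyPLaplace

theorem theorem3p2 (N : ℕ) (p γ γ₂ : ℝ) (α : ℝ≥0)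
    (hp : 1 < p) (hpN : p < N)
    (hγ : 0 ≤ γ) (hγp : γ < ((N - p) / p) ^ p)
    (hγ₂ : IsGreatest (HardyPLaplace.exponentRoots N p γ) γ₂)
    (hα : 0 < α) (hα1 : α < 1)
    (v : EuclideanSpace ℝ (Fin N) → ℝ)
    (hreg : HardyPLaplace.IsC1HolderLoc α {0}ᶜ v)
    (hpos : ∀ x, x ≠ 0 → 0 < v x)
    (hsol : HardyPLaplace.IsWeakSolution p γ v)
    (hzero : Tendsto v (𝓝[≠] 0) atTop)
    (hinfty : HardyPLaplace.HasTwoSidedDecay γ₂ v) :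
    ∃ f : ℝ → ℝ, (∀ x, x ≠ 0 → v x = f ‖x‖) ∧
      StrictAntiOn f (Ioi 0) ∧ ∀ r, 0 < r → deriv f r < 0 := by
  have hN : 0 < N := by
    have : (0 : ℝ) < N := by linarith
    exact_mod_cast this
  have : Nonempty (Fin N) := ⟨⟨0, hN⟩⟩
  have hγ₂lt := HardyPLaplace.lt_of_isGreatest_exponentRoots hp hpN hγ hγp hγ₂
  have hv := hreg.1
  obtain ⟨_, C, R, _, hC, _, hdec⟩ := hinfty
  have hw : ∀ φ : EuclideanSpace ℝ (Fin N) → ℝ, ContDiff ℝ ∞ φ → HasCompactSupport φ →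
      tsupport φ ⊆ {0}ᶜ → ∫ x, inner ℝ (HardyPLaplace.flux p (∇ v x)) (∇ φ x) =
        ∫ x, (γ / ‖x‖ ^ p * v x ^ (p - 1)) * φ x := by
    intro φ h1 h2 h3
    rw [← hsol φ h1 h2 h3]
    simp only [HardyPLaplace.flux, real_inner_smul_left]
  have hV : ContinuousOn (fun x : EuclideanSpace ℝ (Fin N) => γ / ‖x‖ ^ p) {0}ᶜ :=
    continuousOn_const.div
      (continuous_norm.continuousOn.rpow_const fun _ _ => Or.inr (by linarith)) fun x hx =>
        (Real.rpow_pos_of_pos (norm_pos_iff.2 hx) _).ne'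
  have hR := HardyPLaplace.isRiccatiSolution_log hp isOpen_compl_singleton hV hv hpos hw
  have hg : 0 ≤ γ₂ := hγ₂.1.1
  refine HardyPLaplace.exists_radial_profile hp (fun x hx => ?_) hw hv hzero fun x y hy hxy =>
    HardyPLaplace.le_of_norm_lt hp hγ hv hpos hR hzero hC.le hg (fun x hx => (hdec x hx).2) ?_ hy hxy
  · have := hpos x hx
    positivity
  · rw [finrank_euclideanSpace_fin]
    rwa [div_lt_iff₀ (by linarith)] at hγ₂lt
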